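/- **Model.** Fix a dimension $d\ge 1$. A network is given by the following data. - A multi-slope pathloss function $l(r)=\sum_{k=0}^{K-1}A_k r^{\beta_k}\mathbf 1(R_k\le r<R_{k+1})$, where $K\ge1$, $0=R_0<R_1<\dots<R_K=R_\infty<\infty$, $A_k>0$, $\beta_0\ge 0$, $\beta_k\ge d-1$ for $1\le k\le K-1$, $\beta_k<\beta_{k+1}$ and $A_kR_{k+1}^{\beta_k}=A_{k+1}R_{k+1}^{\beta_{k+1}}$ for $0\le k\le K-2$. - A distribution $F_m$ of the channel power on $[0,\infty)$, not concentrated at $0$. - A noise power $W\in(0,\infty)$. At density $\lambda$, the nodes $\{x_i\}$ form a homogeneous Poisson point process of intensity $\lambda$ on the ball of radius $R_\infty$ about the origin of $\mathbb R^d$ (where the user is). Independently of the positions, the nodes carry i.i.d. channel powers $m_i\sim F_m$. The user receives power $P_i=m_i/l(\|x_i\|)$ from node $i$, and under strongest cell association $$\mathrm{SINR}(\lambda)=\max_i \frac{P_i}{\sum_{j\ne i}P_j+W}$$ (equal to $0$ if there are no nodes). Let $P=m/l(\|x\|)$, with $x$ uniform on the ball and $m\sim F_m$ independent of $x$, be the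 power received from a random node, and let $\bar F(t)=\mathbb P(P>t)$. A positive measurable function $h$ on $(0,\infty)$ is regularly varying with index $-\alpha$, $\alpha\in[0,\infty)$, if $h(tx)/h(x)\to t^{-\alpha}$ as $x\to\infty$ for every $t>0$. It has index $-\infty$ if this ratio tends to $0$ for $t>1$ and to $\infty$ for $0<t<1$. **Theorem.** Consider two networks (in the same dimension, each with its own pathloss, channel power distribution and noise power) with the same density $\lambda$. Suppose their received-power tails $\bar F_1,\bar F_2$ are regularly varying with indices $-\alpha_1$ and $-\alpha_2$, where $0\le\alpha_1\le\alpha_2\le\infty$. Then: 1. The limits $\lim_{\lambda\to\infty}\mathbb E(\log(1+\mathrm{SINR}_1(\lambda)))$ and $\lim_{\lambda\to\infty}\mathbb E(\log(1+\mathrm{SINR}_2(\lambda)))$ exist in $[0,\infty]$, and the first is greater than or equal to the second. 2. The limits $\lim_{\lambda\to\infty}\mathbb E(\mathrm{SINR}_1(\lambda))$ and $\lim_{\lambda\to\infty}\mathbb E(\mathrm{SINR}_2(\lambda))$ exist in $[0,\infty]$, and the first is greater than or equal to the second, provided that, in the borderline case $\alpha_1=\alpha_2=1$, it is not the case that $\mathbb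 E(P_1)<\infty=\mathbb E(P_2)$. For $(\alpha_1,\alpha_2)\neq(1,1)$ there is no proviso. -/

import Mathlib

open MeasureTheory ProbabilityTheory Filter Topology Set
open scoped ENNReal NNReal

universe u v

namespace DenseNetwork

/-! ### Regular variation at infinity -/

/-- `h` is a positive Lebesgue measurable function on `(0, ∞)` with
`h (t x) / h x → t ^ ρ` as `x → ∞`, for every `t > 0`. -/
def RegularlyVarying (h : ℝ → ℝ) (ρ : ℝ) : Prop :=
  AEMeasurable h (volume.restrict (Ioi 0)) ∧ (∀ x, 0 < x → 0 < h x) ∧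
    ∀ t, 0 < t → Tendsto (fun x => h (t * x) / h x) atTop (𝓝 (t ^ ρ))

/-- Regular variation with index `-∞`: `h (t x) / h x` tends to `t ^ (-∞)`, that is to `0` for
`t > 1` and to `∞` for `0 < t < 1`. -/
def RapidlyVarying (h : ℝ → ℝ) : Prop :=
  AEMeasurable h (volume.restrict (Ioi 0)) ∧ (∀ x, 0 < x → 0 < h x) ∧
    (∀ t, 1 < t → Tendsto (fun x => h (t * x) / h x) atTop (𝓝 0)) ∧
    (∀ t, 0 < t → t < 1 → Tendsto (fun x => h (t * x) / h x) atTop atTop)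

/-- `h` is regularly varying at infinity with index `-α`, where `α ∈ [0, ∞]`. -/
def RegVaryingNeg (h : ℝ → ℝ) (α : ℝ≥0∞) : Prop :=
  (α ≠ ⊤ ∧ RegularlyVarying h (-α.toReal)) ∨ (α = ⊤ ∧ RapidlyVarying h)

/-! ### The network model -/

/-- Parameters of a multi-slope pathloss function in dimension `d`, with `K` slopes. Only the
values `R 0, …, R K` and `A k`, `β k` with `k < K` matter. -/
structure Pathloss (d : ℕ) where
  K : ℕ
  one_le_K : 1 ≤ K
  R : ℕ → ℝ
  A : ℕ → ℝ
  β : ℕ → ℝ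
  R_zero : R 0 = 0
  R_lt : ∀ k, k < K → R k < R (k + 1)
  β_zero_nonneg : 0 ≤ β 0
  β_ge : ∀ k, 1 ≤ k → k < K → (d : ℝ) - 1 ≤ β k
  β_lt : ∀ k, k + 1 < K → β k < β (k + 1)
  A_pos : ∀ k, k < K → 0 < A k
  continuity : ∀ k, k + 1 < K → A k * R (k + 1) ^ β k = A (k + 1) * R (k + 1) ^ β (k + 1)

namespace Pathloss

variable {d : ℕ}

/-- The radius `R_∞` of the network domain. -/
def Rinf (L : Pathloss d) : ℝ := L.R L.K

/-- The pathloss function `l(r) = ∑ₖ Aₖ r ^ βₖ 1(Rₖ ≤ r < Rₖ₊₁)`. -/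
noncomputable def l (L : Pathloss d) (r : ℝ) : ℝ :=
  ∑ k ∈ Finset.range L.K, (Ico (L.R k) (L.R (k + 1))).indicator (fun s => L.A k * s ^ L.β k) r

end Pathloss

/-- The density-independent data of a wireless network: pathloss, distribution `F_m` of the
nonnegative, not identically zero channel power, and noise power `W`. -/
structure Network (d : ℕ) where
  pathloss : Pathloss d
  chan : Measure ℝ
  chan_prob : IsProbabilityMeasure chan
  chan_nonneg : ∀ᵐ m ∂chan, 0 ≤ m
  chan_ne_zero : ¬ ∀ᵐ m ∂chan, m = 0
  noise : ℝ
  noise_pos : 0 < noise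

namespace Network

variable {d : ℕ}

/-- The network domain: the ball of radius `R_∞` about the user, who sits at the origin. -/
def domain (net : Network d) : Set (EuclideanSpace ℝ (Fin d)) :=
  Metric.ball 0 net.pathloss.Rinf

/-- Received power from a node at `x` with channel power `m`. -/
noncomputable def power (net : Network d) (x : EuclideanSpace ℝ (Fin d)) (m : ℝ) : ℝ :=
  m / net.pathloss.l ‖x‖

/-- Joint law of position and channel power of a random node: the position is uniform on the
domain and independent of the channel power. -/
noncomputable def nodeLaw (net : Network d) : Measure (EuclideanSpace ℝ (Fin d) × ℝ) :=
  (volume[|net.domain]).prod net.chan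

/-- The tail `t ↦ ℙ(P > t)` of the power `P` received from a random node. -/
noncomputable def tail (net : Network d) (t : ℝ) : ℝ :=
  net.nodeLaw.real {p | t < net.power p.1 p.2}

/-- The expectation `𝔼(P) ∈ [0, ∞]` of the power `P` received from a random node. -/
noncomputable def meanPower (net : Network d) : ℝ≥0∞ :=
  ∫⁻ p, ENNReal.ofReal (net.power p.1 p.2) ∂net.nodeLaw

end Network

/-! ### Poisson point processes -/

section Poisson

variable {Ω E : Type*} [MeasurableSpace Ω] [MeasurableSpace E]

/-- The number of points in `A` of the finite configuration `x 0 ω, …, x (N ω - 1) ω`. -/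
noncomputable def count (N : Ω → ℕ) (x : ℕ → Ω → E) (A : Set E) (ω : Ω) : ℕ :=
  ∑ i ∈ Finset.range (N ω), A.indicator (fun _ => 1) (x i ω)

/-- The random points `x 0, …, x (N - 1)` form a Poisson point process with finite intensity
measure `Λ`: the number of points in any measurable `A` is Poisson distributed with mean `Λ A`, and
the numbers of points in pairwise disjoint sets are independent. -/
structure IsPoissonProcess (μ : Measure Ω) (Λ : Measure E) (N : Ω → ℕ) (x : ℕ → Ω → E) :
    Prop where
  measurable_num : Measurable N
  measurable_point : ∀ i, Measurable (x i)
  count_law : ∀ A, MeasurableSet A → HasLaw (count N x A) (poissonMeasure (Λ A).toNNReal) μ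
  count_indep : ∀ (k : ℕ) (A : Fin k → Set E), (∀ j, MeasurableSet (A j)) →
    Pairwise (fun i j => Disjoint (A i) (A j)) → iIndepFun (fun j => count N x (A j)) μ

end Poisson

/-- A realization of the network `net` with density `lam` on some probability space: the nodes
`x 0, …, x (N - 1)` form a homogeneous Poisson point process of intensity `lam` on the domain,
independently marked by channel powers `m i` with distribution `F_m`. -/
structure Realization {d : ℕ} (net : Network d) (lam : ℝ≥0) where
  Ω : Type u
  mΩ : MeasurableSpace Ω
  μ : Measure Ω
  prob : IsProbabilityMeasure μ
  N : Ω → ℕ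
  x : ℕ → Ω → EuclideanSpace ℝ (Fin d)
  m : ℕ → Ω → ℝ
  poisson : IsPoissonProcess μ (lam • volume.restrict net.domain) N x
  measurable_mark : ∀ i, Measurable (m i)
  mark_law : ∀ i, HasLaw (m i) net.chan μ
  mark_indep : iIndepFun m μ
  mark_indep_points : IndepFun (fun ω i => m i ω) (fun ω => (N ω, fun i => x i ω)) μ

namespace Realization

variable {d : ℕ} {net : Network d} {lam : ℝ≥0}

/-- Power `P_i` received from node `i`. -/
noncomputable def P (Ξ : Realization net lam) (i : ℕ) (ω : Ξ.Ω) : ℝ :=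
  net.power (Ξ.x i ω) (Ξ.m i ω)

/-- Interference `I_i`, the total power received from the nodes other than `i`. -/
noncomputable def interference (Ξ : Realization net lam) (i : ℕ) (ω : Ξ.Ω) : ℝ :=
  ∑ j ∈ (Finset.range (Ξ.N ω)).erase i, Ξ.P j ω

/-- Signal quality `Q_i = P_i / (I_i + W)` of node `i`. -/
noncomputable def Q (Ξ : Realization net lam) (i : ℕ) (ω : Ξ.Ω) : ℝ :=
  Ξ.P i ω / (Ξ.interference i ω + net.noise)

/-- The SINR under strongest cell association, `max_i Q_i`; it is `0` if there is no node. -/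
noncomputable def sinr (Ξ : Realization net lam) (ω : Ξ.Ω) : ℝ :=
  ⨆ i : Fin (Ξ.N ω), Ξ.Q i ω

/-- `𝔼(SINR) ∈ [0, ∞]`. -/
noncomputable def meanSinr (Ξ : Realization net lam) : ℝ≥0∞ :=
  @lintegral Ξ.Ω Ξ.mΩ Ξ.μ fun ω => ENNReal.ofReal (Ξ.sinr ω)

/-- The average rate `𝔼(log(1 + SINR)) ∈ [0, ∞]`. -/
noncomputable def meanRate (Ξ : Realization net lam) : ℝ≥0∞ :=
  @lintegral Ξ.Ω Ξ.mΩ Ξ.μ fun ω => ENNReal.ofReal (Real.log (1 + Ξ.sinr ω))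

end Realization

end DenseNetwork

/-! Let π be the law of the power received from a random node, G its upper quantile function, and Λ
the density times the volume of the domain. The received powers behave like G(x_i), where the x_i
form a Poisson process of rate Λ on (0,1). The strongest node has the smallest coordinate x, and
given x the other nodes are Poisson on (x,1). With S the total and M the maximal power, 1/SINR = (S
- M + W)/M, so its Laplace transform on {M > 0} has the closed form `sinrLaplace`; this is
`Realization.lintegral_exp_div_sinr`. Since 1/T = ∫ exp(-sT) ds and log(1 + 1/T) = ∫ w(s) exp(-sT)
ds with w = `logWeight`, both expectations are integrals of this one function over s > 0.

Rate. Put x = u/Λ. Regular variation of the tail inverts to G(v/Λ)/G(u/Λ) → (v/u)^(-1/α) for v > u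
(`tendsto_quantile_ratio`), while G(u/Λ) → ∞ removes the noise. Hence the limit depends on α alone,
and it decreases in α because a lighter tail makes the competitors relatively stronger
(`limitRate_anti`). For α > 0 the passage to the limit under the integral over s rests on the bound
of order s^(-δ), uniform in Λ, of `exists_sinrDensity_div_le`; for α = 0 the limit is infinite and
Fatou's lemma suffices.

Mean SINR. Here there is a dichotomy. If 𝔼(P) = ∞, the event that there is exactly one node already
makes the mean infinite at every positive density. If 𝔼(P) < ∞, the contribution of the coordinate x
is at most C G(x) exp(-Λx/2) (`exists_lintegral_sinrDensity_le`), and dominated convergence gives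
the limit 0. Potter-type bounds on G show that 𝔼(P) is infinite for α < 1 and finite for α > 1, so
only α₁ = α₂ = 1 needs the proviso. -/

namespace DenseNetwork

/-! ### Upper quantiles -/

/-- The upper quantile function of `π` on `(0, 1)`, for `π` concentrated on `[0, ∞)`. -/
noncomputable def quantile (π : Measure ℝ) (x : ℝ) : ℝ := sInf {t | 0 ≤ t ∧ π.real (Ioi t) ≤ x}

section Quantile

variable {π : Measure ℝ}

theorem bddBelow_quantileSet (x : ℝ) : BddBelow {t | 0 ≤ t ∧ π.real (Ioi t) ≤ x} :=
  ⟨0, fun _ h => h.1⟩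

theorem quantile_nonneg (x : ℝ) : 0 ≤ quantile π x := Real.sInf_nonneg fun _ h => h.1

theorem measureReal_Ioi_eq [IsProbabilityMeasure π] (t : ℝ) : π.real (Ioi t) = 1 - cdf π t := by
  rw [cdf_eq_real, ← compl_Iic, measureReal_compl measurableSet_Iic, probReal_univ]

theorem antitone_measureReal_Ioi [IsFiniteMeasure π] : Antitone fun t => π.real (Ioi t) :=
  fun _ _ h => measureReal_mono (Ioi_subset_Ioi h)

theorem quantileSet_nonempty [IsProbabilityMeasure π] {x : ℝ} (hx : 0 < x) :
    {t | 0 ≤ t ∧ π.real (Ioi t) ≤ x}.Nonempty := by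
  have h : ∀ᶠ t in atTop, 1 - x < cdf π t :=
    (tendsto_order.1 (tendsto_cdf_atTop π)).1 _ (by linarith)
  obtain ⟨t, ht, ht0⟩ := (h.and (eventually_ge_atTop 0)).exists
  exact ⟨t, ht0, by rw [measureReal_Ioi_eq]; linarith⟩

/-- The infimum defining the quantile is attained, because the tail is right-continuous. -/
theorem quantile_le_iff [IsProbabilityMeasure π] {x t : ℝ} (hx : 0 < x) (ht : 0 ≤ t) :
    quantile π x ≤ t ↔ π.real (Ioi t) ≤ x := by
  refine ⟨fun h => ?_, fun h => csInf_le (bddBelow_quantileSet x) ⟨ht, h⟩⟩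
  have key : ∀ s, t < s → π.real (Ioi s) ≤ x := fun s hs => by
    obtain ⟨r, hr, hrs⟩ := exists_lt_of_csInf_lt (quantileSet_nonempty hx) (h.trans_lt hs)
    exact (antitone_measureReal_Ioi hrs.le).trans hr.2
  have hc : Tendsto (cdf π) (𝓝[>] t) (𝓝 (cdf π t)) :=
    ((cdf π).right_continuous t).tendsto.mono_left (nhdsWithin_mono _ Ioi_subset_Ici_self)
  have := le_of_tendsto (hc.const_sub 1) (b := x) (by
    filter_upwards [self_mem_nhdsWithin] with s hs
    rw [← measureReal_Ioi_eq]; exact key s hs)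
  rwa [measureReal_Ioi_eq]

theorem lt_quantile_iff [IsProbabilityMeasure π] {x t : ℝ} (hx : 0 < x) (ht : 0 ≤ t) :
    t < quantile π x ↔ x < π.real (Ioi t) := by
  simpa using not_congr (quantile_le_iff (π := π) hx ht)

theorem antitoneOn_quantile [IsProbabilityMeasure π] : AntitoneOn (quantile π) (Ioi 0) :=
  fun _ hx _ _ hxy => csInf_le_csInf (bddBelow_quantileSet _) (quantileSet_nonempty hx)
    fun _ h => ⟨h.1, h.2.trans hxy⟩

theorem measurable_quantile [IsProbabilityMeasure π] : Measurable (quantile π) := by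
  refine measurable_of_Iic fun t => ?_
  rcases lt_or_ge t 0 with ht | ht
  · convert MeasurableSet.empty
    ext x
    simpa using ht.trans_le (quantile_nonneg x)
  -- For negative arguments the defining set is empty and its `sInf` is 0 ≤ t; the argument 0 stays
  -- undecided, but contributes at most one point.
  · have h : quantile π ⁻¹' Iic t =
        (Iio 0 ∪ (Ioi 0 ∩ Ici (π.real (Ioi t)))) ∪ (quantile π ⁻¹' Iic t ∩ {0}) := by
      ext x
      rcases lt_trichotomy x 0 with hx | hx | hx
      · have : quantile π x = 0 := by
          rw [quantile, show {t | 0 ≤ t ∧ π.real (Ioi t) ≤ x} = ∅ from ?_, Real.sInf_empty]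
          ext r
          simpa using fun _ => hx.trans_le measureReal_nonneg
        simp [hx, this, ht]
      · simp [hx]
      · simp [hx.ne', hx.not_gt, hx, quantile_le_iff hx ht]
    rw [h]
    refine (measurableSet_Iio.union (measurableSet_Ioi.inter measurableSet_Ici)).union ?_
    exact (subsingleton_singleton.anti inter_subset_right).measurableSet

/-- Inverse transform sampling: within (0,1), the set where the quantile exceeds t ≥ 0 is the
interval from 0 to the tail at t. -/
theorem map_quantile [IsProbabilityMeasure π] (h0 : π (Iio 0) = 0) :
    (volume.restrict (Ioo (0 : ℝ) 1)).map (quantile π) = π := by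
  have : IsProbabilityMeasure (volume.restrict (Ioo (0 : ℝ) 1)) := ⟨by simp⟩
  have := Measure.isProbabilityMeasure_map (μ := volume.restrict (Ioo (0 : ℝ) 1))
    (measurable_quantile (π := π)).aemeasurable
  refine Measure.ext_of_Iic _ _ fun t => ?_
  rw [← compl_Ioi, prob_compl_eq_one_sub measurableSet_Ioi, prob_compl_eq_one_sub measurableSet_Ioi]
  congr 1
  rw [Measure.map_apply measurable_quantile measurableSet_Ioi,
    Measure.restrict_apply (measurable_quantile measurableSet_Ioi)]
  rcases lt_or_ge t 0 with ht | ht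
  · rw [show quantile π ⁻¹' Ioi t ∩ Ioo 0 1 = Ioo 0 1 from
      inter_eq_right.2 fun x _ => ht.trans_le (quantile_nonneg x)]
    have : π (Ioi t) = 1 := by
      rw [← prob_compl_eq_zero_iff measurableSet_Ioi, compl_Ioi]
      exact measure_mono_null (Iic_subset_Iio.2 ht) h0
    simp [this]
  · have : quantile π ⁻¹' Ioi t ∩ Ioo 0 1 = Ioo 0 (π.real (Ioi t)) := by
      ext x
      simp only [mem_inter_iff, mem_preimage, mem_Ioi, mem_Ioo]
      refine ⟨fun h => ⟨h.2.1, (lt_quantile_iff h.2.1 ht).1 h.1⟩, fun h =>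
        ⟨(lt_quantile_iff h.1 ht).2 h.2, h.1, h.2.trans_le measureReal_le_one⟩⟩
    rw [this, Real.volume_Ioo, sub_zero, ofReal_measureReal]

theorem tendsto_quantile_zero [IsProbabilityMeasure π] (hpos : ∀ t, 0 < t → 0 < π.real (Ioi t)) :
    Tendsto (quantile π) (𝓝[>] 0) atTop := by
  refine tendsto_atTop.2 fun t => ?_
  filter_upwards [Ioo_mem_nhdsGT (hpos (max t 1) (by positivity))] with x hx
  exact (le_max_left t 1).trans ((lt_quantile_iff hx.1 (by positivity)).2 hx.2).le

/-- A Potter bound. Iterating the doubling inequality from the level G(v) gives tail at most 2^(-an)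
v at 2^n G(v). Taking 2^n to be (v/u)^(1/a) up to rounding brings this below u; the factor 2 pays
for the rounding. -/
theorem quantile_le_mul_rpow [IsProbabilityMeasure π] (hpos : ∀ t, 0 < t → 0 < π.real (Ioi t))
    {a : ℝ} (ha : 0 < a)
    (h : ∀ᶠ t in atTop, π.real (Ioi (2 * t)) ≤ 2 ^ (-a) * π.real (Ioi t)) :
    ∃ x₀, 0 < x₀ ∧ x₀ < 1 ∧ ∀ u v, 0 < u → u ≤ v → v ≤ x₀ →
      quantile π u ≤ 2 * (v / u) ^ a⁻¹ * quantile π v := by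
  obtain ⟨t₁, ht₁⟩ := eventually_atTop.1 h
  set t₀ := max t₁ 1
  have ht₀ : 0 < t₀ := by positivity
  have hp : π.real (Ioi t₀) ≤ 1 := measureReal_le_one
  -- Halving the tail at t₀ makes it strictly larger than every v ≤ x₀, so that G(v) > t₀ and the
  -- doubling inequality applies from G(v) upwards.
  refine ⟨π.real (Ioi t₀) / 2, half_pos (hpos _ ht₀), by linarith, fun u v hu huv hv => ?_⟩
  have hv0 : 0 < v := hu.trans_le huv
  have hlt : t₀ < quantile π v :=
    (lt_quantile_iff hv0 ht₀.le).2 (by linarith [hpos _ ht₀])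
  have it : ∀ n : ℕ, π.real (Ioi (2 ^ n * quantile π v)) ≤ (2 ^ (-a)) ^ n * v := by
    intro n
    induction n with
    | zero => simpa using (quantile_le_iff hv0 (quantile_nonneg v)).1 le_rfl
    | succ n ih =>
      have h1 : t₁ ≤ 2 ^ n * quantile π v := by
        have : (1 : ℝ) ≤ 2 ^ n := one_le_pow₀ one_le_two
        nlinarith [le_max_left t₁ 1]
      calc π.real (Ioi (2 ^ (n + 1) * quantile π v))
          = π.real (Ioi (2 * (2 ^ n * quantile π v))) := by rw [pow_succ']; ring_nf
        _ ≤ 2 ^ (-a) * π.real (Ioi (2 ^ n * quantile π v)) := ht₁ _ h1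
        _ ≤ 2 ^ (-a) * ((2 ^ (-a)) ^ n * v) := by gcongr
        _ = _ := by ring
  have hy1 : 1 ≤ (v / u) ^ a⁻¹ := Real.one_le_rpow ((one_le_div hu).2 huv) (by positivity)
  obtain ⟨n, hn1, hn2⟩ := exists_nat_pow_near hy1 one_lt_two
  have hq : quantile π u ≤ 2 ^ (n + 1) * quantile π v := by
    refine (quantile_le_iff hu (by have := quantile_nonneg (π := π) v; positivity)).2
      ((it (n + 1)).trans ?_)
    have h2 : v / u ≤ ((2 : ℝ) ^ (n + 1)) ^ a := by
      calc v / u = ((v / u) ^ a⁻¹) ^ a := (Real.rpow_inv_rpow (by positivity) ha.ne').symm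
        _ ≤ _ := by gcongr
    have h3 : ((2 : ℝ) ^ (-a)) ^ (n + 1) = (((2 : ℝ) ^ (n + 1)) ^ a)⁻¹ := by
      rw [Real.rpow_neg (by norm_num), inv_pow, ← Real.rpow_natCast, ← Real.rpow_mul (by norm_num),
        mul_comm a, Real.rpow_mul (by norm_num), Real.rpow_natCast]
    rw [h3, inv_mul_le_iff₀ (by positivity)]
    rwa [div_le_iff₀ hu] at h2
  calc quantile π u ≤ 2 ^ (n + 1) * quantile π v := hq
    _ = 2 * 2 ^ n * quantile π v := by ring
    _ ≤ _ := by have := quantile_nonneg (π := π) v; gcongr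

theorem le_quantile_mul_rpow [IsProbabilityMeasure π] (hpos : ∀ t, 0 < t → 0 < π.real (Ioi t))
    {a : ℝ} (ha : 0 < a)
    (h : ∀ᶠ t in atTop, 2 ^ (-a) * π.real (Ioi t) ≤ π.real (Ioi (2 * t))) :
    ∃ x₀, 0 < x₀ ∧ x₀ < 1 ∧ ∀ u v, 0 < u → u ≤ v → v ≤ x₀ →
      quantile π v ≤ 2 * (u / v) ^ a⁻¹ * quantile π u := by
  obtain ⟨t₁, ht₁⟩ := eventually_atTop.1 h
  set t₀ := max t₁ 1
  have ht₀ : 0 < t₀ := by positivity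
  have hp : π.real (Ioi t₀) ≤ 1 := measureReal_le_one
  refine ⟨π.real (Ioi t₀) / 2, half_pos (hpos _ ht₀), by linarith, fun u v hu huv hv => ?_⟩
  have hv0 : 0 < v := hu.trans_le huv
  have hlt : t₀ < quantile π v :=
    (lt_quantile_iff hv0 ht₀.le).2 (by linarith [hpos _ ht₀])
  -- The tail at G(v) itself may lie below v, so the iteration starts at levels t < G(v), where the
  -- tail exceeds v; afterwards t increases to G(v).
  have it : ∀ t, t₀ ≤ t → t < quantile π v → ∀ n : ℕ,
      (2 ^ (-a)) ^ n * v < π.real (Ioi (2 ^ n * t)) := by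
    intro t ht htv n
    induction n with
    | zero => simpa using (lt_quantile_iff hv0 (ht₀.le.trans ht)).1 htv
    | succ n ih =>
      have h1 : t₁ ≤ 2 ^ n * t := by
        have : (1 : ℝ) ≤ 2 ^ n := one_le_pow₀ one_le_two
        nlinarith [le_max_left t₁ 1]
      calc (2 ^ (-a)) ^ (n + 1) * v = 2 ^ (-a) * ((2 ^ (-a)) ^ n * v) := by ring
        _ < 2 ^ (-a) * π.real (Ioi (2 ^ n * t)) := by gcongr
        _ ≤ π.real (Ioi (2 * (2 ^ n * t))) := ht₁ _ h1
        _ = _ := by rw [pow_succ']; ring_nf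
  have hy1 : 1 ≤ (v / u) ^ a⁻¹ := Real.one_le_rpow ((one_le_div hu).2 huv) (by positivity)
  obtain ⟨n, hn1, hn2⟩ := exists_nat_pow_near hy1 one_lt_two
  have hq : ∀ t, t₀ ≤ t → t < quantile π v → 2 ^ n * t ≤ quantile π u := by
    intro t ht htv
    refine ((lt_quantile_iff hu (by have := ht₀.le.trans ht; positivity)).2
      (lt_of_le_of_lt ?_ (it t ht htv n))).le
    have h2 : ((2 : ℝ) ^ n) ^ a ≤ v / u := by
      calc _ ≤ ((v / u) ^ a⁻¹) ^ a := by gcongr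
        _ = _ := (Real.rpow_inv_rpow (by positivity) ha.ne')
    have h3 : ((2 : ℝ) ^ (-a)) ^ n = (((2 : ℝ) ^ n) ^ a)⁻¹ := by
      rw [Real.rpow_neg (by norm_num), inv_pow, ← Real.rpow_natCast, ← Real.rpow_mul (by norm_num),
        mul_comm a, Real.rpow_mul (by norm_num), Real.rpow_natCast]
    rw [h3, le_inv_mul_iff₀ (by positivity)]
    rwa [le_div_iff₀ hu] at h2
  have hq' : 2 ^ n * quantile π v ≤ quantile π u := by
    rw [← le_div_iff₀' (by positivity)]
    refine le_of_forall_lt_imp_le_of_dense fun t ht => ?_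
    rw [le_div_iff₀' (by positivity)]
    refine le_trans ?_ (hq (max t t₀) (le_max_right _ _) (max_lt ht hlt))
    gcongr
    exact le_max_left _ _
  have h5 : (u / v) ^ a⁻¹ = ((v / u) ^ a⁻¹)⁻¹ := by
    rw [← Real.inv_rpow (by positivity), inv_div]
  rw [h5, mul_assoc, mul_comm, mul_assoc, le_inv_mul_iff₀ (by positivity)]
  calc (v / u) ^ a⁻¹ * quantile π v ≤ 2 ^ (n + 1) * quantile π v := by
        have := quantile_nonneg (π := π) v; gcongr
    _ = (2 ^ n * quantile π v) * 2 := by ring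
    _ ≤ _ := by gcongr

end Quantile

/-! ### Regularly varying tails -/

/-- `y ^ (-1 / α)`, the limit of `G (y x) / G x` as `x → 0`, for `y > 1` and `G` the upper
quantile function of a law whose tail is regularly varying with index `-α`. -/
noncomputable def ratioLimit (α : ℝ≥0∞) (y : ℝ) : ℝ :=
  if α = 0 then 0 else y ^ (-(α⁻¹).toReal)

theorem ratioLimit_nonneg {α : ℝ≥0∞} {y : ℝ} (hy : 0 ≤ y) : 0 ≤ ratioLimit α y := by
  unfold ratioLimit; split_ifs <;> positivity

theorem ratioLimit_mono {α₁ α₂ : ℝ≥0∞} (h : α₁ ≤ α₂) {y : ℝ} (hy : 1 ≤ y) :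
    ratioLimit α₁ y ≤ ratioLimit α₂ y := by
  rcases eq_or_ne α₁ 0 with h0 | h0
  · rw [ratioLimit, if_pos h0]; exact ratioLimit_nonneg (by linarith)
  · have h2 : α₂ ≠ 0 := (h.trans_lt' (pos_iff_ne_zero.2 h0)).ne'
    rw [ratioLimit, ratioLimit, if_neg h0, if_neg h2]
    refine Real.rpow_le_rpow_of_exponent_le hy (neg_le_neg ?_)
    exact ENNReal.toReal_mono (by simpa using h0) (ENNReal.inv_le_inv.2 h)

section RegVarying

variable {f : ℝ → ℝ} {α : ℝ≥0∞}

theorem RegVaryingNeg.pos (h : RegVaryingNeg f α) {t : ℝ} (ht : 0 < t) : 0 < f t := by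
  rcases h with h | h
  · exact h.2.2.1 t ht
  · exact h.2.2.1 t ht

/-- For 0 < α < ∞, θ > y^(-1/α) means θ^(-α) < y. For α = 0 the ratio tends to 1 < y; for α = ∞ the
threshold is 1 and the ratio tends to 0 beyond it. -/
theorem RegVaryingNeg.eventually_lt (h : RegVaryingNeg f α) {y θ : ℝ} (hy : 1 < y)
    (hθ : ratioLimit α y < θ) : ∀ᶠ t in atTop, f (θ * t) < y * f t := by
  have hθ0 : 0 < θ := (ratioLimit_nonneg (by linarith)).trans_lt hθ
  have key : ∀ᶠ t in atTop, f (θ * t) / f t < y := by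
    rcases h with ⟨hα, -, hp, hl⟩ | ⟨hα, -, hp, hl, -⟩
    · refine (tendsto_order.1 (hl θ hθ0)).2 _ ?_
      rcases eq_or_ne α 0 with h0 | h0
      · simpa [h0] using hy
      · rw [ratioLimit, if_neg h0, ENNReal.toReal_inv] at hθ
        have ha : 0 < α.toReal := ENNReal.toReal_pos h0 hα
        have := Real.rpow_lt_rpow_of_neg (by positivity) hθ (neg_lt_zero.2 ha)
        rwa [← Real.rpow_mul (by linarith), neg_mul_neg, inv_mul_cancel₀ ha.ne', Real.rpow_one]
          at this
    · refine (tendsto_order.1 (hl θ ?_)).2 _ (by linarith)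
      simpa [hα, ratioLimit] using hθ
  filter_upwards [key, eventually_gt_atTop 0] with t ht ht0
  rwa [div_lt_iff₀ (h.pos ht0)] at ht

theorem RegVaryingNeg.eventually_gt (h : RegVaryingNeg f α) {y θ : ℝ} (hy : 1 < y) (hθ0 : 0 < θ)
    (hθ : θ < ratioLimit α y) : ∀ᶠ t in atTop, y * f t < f (θ * t) := by
  have key : ∀ᶠ t in atTop, y < f (θ * t) / f t := by
    rcases h with ⟨hα, -, hp, hl⟩ | ⟨hα, -, hp, -, hl⟩
    · refine (tendsto_order.1 (hl θ hθ0)).1 _ ?_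
      rcases eq_or_ne α 0 with h0 | h0
      · rw [ratioLimit, if_pos h0] at hθ
        exact absurd hθ0 hθ.not_gt
      · rw [ratioLimit, if_neg h0, ENNReal.toReal_inv] at hθ
        have ha : 0 < α.toReal := ENNReal.toReal_pos h0 hα
        have := Real.rpow_lt_rpow_of_neg hθ0 hθ (neg_lt_zero.2 ha)
        rwa [← Real.rpow_mul (by linarith), neg_mul_neg, inv_mul_cancel₀ ha.ne', Real.rpow_one]
          at this
    · refine (hl θ hθ0 ?_).eventually_gt_atTop y
      simpa [hα, ratioLimit] using hθ
  filter_upwards [key, eventually_gt_atTop 0] with t ht ht0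
  rwa [lt_div_iff₀ (h.pos ht0)] at ht

theorem RegVaryingNeg.eventually_two_mul_le (h : RegVaryingNeg f α) {a : ℝ}
    (ha : ENNReal.ofReal a < α) (ha0 : 0 ≤ a) :
    ∀ᶠ t in atTop, f (2 * t) ≤ 2 ^ (-a) * f t := by
  have key : ∀ᶠ t in atTop, f (2 * t) / f t < 2 ^ (-a) := by
    rcases h with ⟨hα, -, hp, hl⟩ | ⟨hα, -, hp, hl, -⟩
    · refine (tendsto_order.1 (hl 2 two_pos)).2 _ ?_
      refine Real.rpow_lt_rpow_of_exponent_lt one_lt_two (neg_lt_neg ?_)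
      exact (ENNReal.ofReal_lt_iff_lt_toReal ha0 hα).1 ha
    · exact (tendsto_order.1 (hl 2 one_lt_two)).2 _ (by positivity)
  filter_upwards [key, eventually_gt_atTop 0] with t ht ht0
  rw [div_lt_iff₀ (h.pos ht0)] at ht
  exact ht.le

theorem RegVaryingNeg.eventually_le_two_mul (h : RegVaryingNeg f α) {a : ℝ}
    (ha : α < ENNReal.ofReal a) :
    ∀ᶠ t in atTop, 2 ^ (-a) * f t ≤ f (2 * t) := by
  have key : ∀ᶠ t in atTop, 2 ^ (-a) < f (2 * t) / f t := by
    rcases h with ⟨hα, -, hp, hl⟩ | ⟨hα, -⟩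
    · refine (tendsto_order.1 (hl 2 two_pos)).1 _ ?_
      refine Real.rpow_lt_rpow_of_exponent_lt one_lt_two (neg_lt_neg ?_)
      exact (ENNReal.lt_ofReal_iff_toReal_lt hα).1 ha
    · simp [hα] at ha
  filter_upwards [key, eventually_gt_atTop 0] with t ht ht0
  rw [lt_div_iff₀ (h.pos ht0)] at ht
  exact ht.le

end RegVarying

/-- Inversion of regular variation: comparing G(yx) with θ G(x) amounts to comparing the tail at θ
G(x) with yx, where x is, up to jumps, the tail at G(x). -/
theorem tendsto_quantile_ratio {π : Measure ℝ} [IsProbabilityMeasure π] {α : ℝ≥0∞}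
    (h : RegVaryingNeg (fun t => π.real (Ioi t)) α) {y : ℝ} (hy : 1 < y) :
    Tendsto (fun x => quantile π (y * x) / quantile π x) (𝓝[>] 0) (𝓝 (ratioLimit α y)) := by
  have hG := tendsto_quantile_zero fun t ht => h.pos ht
  refine tendsto_order.2 ⟨fun θ hθ => ?_, fun θ hθ => ?_⟩
  · rcases lt_or_ge θ 0 with h0 | h0
    · exact Eventually.of_forall fun x =>
        h0.trans_le (div_nonneg (quantile_nonneg _) (quantile_nonneg _))
    -- Two intermediate values are needed: the tail exceeds x only strictly below G(x), so the tail
    -- estimate is used at (θ₁/θ') G(x) instead of G(x).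
    obtain ⟨θ₁, h1, h2⟩ := exists_between hθ
    obtain ⟨θ', h3, h4⟩ := exists_between h2
    have hθ₁ : 0 < θ₁ := h0.trans_lt h1
    have hθ' : 0 < θ' := hθ₁.trans h3
    have hδ : 0 < θ₁ / θ' := by positivity
    have hδ1 : θ₁ / θ' < 1 := (div_lt_one hθ').2 h3
    filter_upwards [(hG.const_mul_atTop hδ).eventually (h.eventually_gt hy hθ' h4),
      hG.eventually_gt_atTop 0, self_mem_nhdsWithin] with x hx hpos (hx0 : 0 < x)
    refine h1.trans ((lt_div_iff₀ hpos).2 ?_)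
    refine (lt_quantile_iff (by positivity) (by positivity)).2 ?_
    have e : θ' * (θ₁ / θ' * quantile π x) = θ₁ * quantile π x := by field_simp
    rw [e] at hx
    refine lt_trans ?_ hx
    gcongr
    exact (lt_quantile_iff hx0 (by positivity)).1 (mul_lt_of_lt_one_left hpos hδ1)
  · obtain ⟨θ', h1, h2⟩ := exists_between hθ
    have hθ' : 0 < θ' := (ratioLimit_nonneg (by linarith)).trans_lt h1
    filter_upwards [hG.eventually (h.eventually_lt hy h1), hG.eventually_gt_atTop 0,
      self_mem_nhdsWithin] with x hx hpos (hx0 : 0 < x)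
    refine lt_of_le_of_lt ((div_le_iff₀ hpos).2 ?_) h2
    refine (quantile_le_iff (by positivity) (by positivity)).2 (hx.le.trans ?_)
    gcongr
    exact (quantile_le_iff hx0 hpos.le).1 le_rfl

/-! ### The probability generating functional of a marked Poisson process -/

theorem lintegral_pow_poissonMeasure (r : ℝ≥0) {c : ℝ} (hc : 0 ≤ c) :
    ∫⁻ n, ENNReal.ofReal c ^ n ∂poissonMeasure r = ENNReal.ofReal (Real.exp (r * (c - 1))) := by
  rw [poissonMeasure, lintegral_sum_measure]
  simp_rw [lintegral_smul_measure, lintegral_dirac, smul_eq_mul, ← ENNReal.ofReal_pow hc]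
  have h1 : ∀ n : ℕ, ENNReal.ofReal (Real.exp (-r) * r ^ n / n.factorial) * ENNReal.ofReal (c ^ n) =
      ENNReal.ofReal (Real.exp (-r) * ((r * c) ^ n / n.factorial)) := fun n => by
    rw [← ENNReal.ofReal_mul (by positivity)]
    congr 1
    rw [mul_pow]
    ring
  simp_rw [h1]
  rw [← ENNReal.ofReal_tsum_of_nonneg (fun n => by positivity)
    ((Real.summable_pow_div_factorial _).mul_left _), tsum_mul_left,
    (NormedSpace.expSeries_div_hasSum_exp ((r : ℝ) * c)).tsum_eq, ← Real.exp_eq_exp_ℝ,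
    ← Real.exp_add]
  congr 2
  ring

theorem measurable_countable_index {Ω β : Type*} [MeasurableSpace Ω] [MeasurableSpace β]
    {N : Ω → ℕ} (hN : Measurable N) {F : ℕ → Ω → β} (hF : ∀ n, Measurable (F n)) :
    Measurable fun ω => F (N ω) ω :=
  (measurable_from_prod_countable_right (f := fun p : ℕ × Ω => F p.1 p.2) hF).comp
    (hN.prodMk measurable_id)

theorem count_eq_card {Ω E : Type*} (N : Ω → ℕ) (x : ℕ → Ω → E) (A : Set E) (ω : Ω)
    [DecidablePred fun i => x i ω ∈ A] :
    count N x A ω = ((Finset.range (N ω)).filter fun i => x i ω ∈ A).card := by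
  rw [Finset.card_filter, count]
  exact Finset.sum_congr rfl fun i _ => by simp only [indicator_apply]

section Poisson

variable {Ω E : Type*} [MeasurableSpace Ω] [MeasurableSpace E] {μ : Measure Ω} {Λ : Measure E}
  {N : Ω → ℕ} {x : ℕ → Ω → E}

theorem IsPoissonProcess.measurable_count (h : IsPoissonProcess μ Λ N x) {A : Set E}
    (hA : MeasurableSet A) : Measurable (count N x A) := by
  refine measurable_countable_index (F := fun n ω => ∑ i ∈ Finset.range n, A.indicator _ (x i ω))
    h.measurable_num fun n => Finset.measurable_fun_sum _ fun i _ => ?_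
  exact (measurable_const.indicator hA).comp (h.measurable_point i)

/-- The fibres of ψ are disjoint, so their counts are independent Poisson variables and the product
factors into Poisson generating functions. -/
theorem IsPoissonProcess.lintegral_prod_simpleFunc [IsFiniteMeasure Λ]
    (h : IsPoissonProcess μ Λ N x) (ψ : SimpleFunc E ℝ) (hψ : ∀ e, ψ e ∈ Icc (0 : ℝ) 1) :
    ∫⁻ ω, ∏ i ∈ Finset.range (N ω), ENNReal.ofReal (1 - ψ (x i ω)) ∂μ =
      ENNReal.ofReal (Real.exp (-∫ e, ψ e ∂Λ)) := by
  classical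
  set A : ψ.range → Set E := fun c => ψ ⁻¹' {c.1}
  have hA : ∀ c, MeasurableSet (A c) := fun c => ψ.measurableSet_fiber c.1
  have hdisj : Pairwise fun c c' => Disjoint (A c) (A c') := fun c c' hcc' =>
    Disjoint.preimage _ (by simpa using fun e => hcc' (Subtype.ext e))
  have hind : iIndepFun (fun c => count N x (A c)) μ := by
    let e := ψ.range.equivFin
    have := h.count_indep ψ.range.card (fun j => A (e.symm j)) (fun j => hA _)
      fun i j hij => hdisj (e.symm.injective.ne hij)
    simpa using this.precomp e.injective
  have hprod : ∀ ω, ∏ i ∈ Finset.range (N ω), ENNReal.ofReal (1 - ψ (x i ω)) =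
      ∏ c : ψ.range, ENNReal.ofReal (1 - c) ^ count N x (A c) ω := fun ω => by
    rw [← Finset.prod_fiberwise_of_maps_to' (g := fun i => ψ (x i ω)) (t := ψ.range)
      (fun i _ => ψ.mem_range_self _) (fun c => ENNReal.ofReal (1 - c))]
    rw [← Finset.prod_coe_sort]
    refine Finset.prod_congr rfl fun c _ => ?_
    rw [Finset.prod_const, count_eq_card]
    rfl
  have hc : ∀ c : ψ.range, 0 ≤ c.1 ∧ c.1 ≤ 1 := fun ⟨c, hc⟩ => by
    obtain ⟨e, rfl⟩ := SimpleFunc.mem_range.1 hc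
    exact hψ e
  simp_rw [hprod]
  rw [lintegral_prod_eq_prod_lintegral_of_indepFun Finset.univ
    (fun (c : ψ.range) ω => ENNReal.ofReal (1 - c) ^ count N x (A c) ω)
    (hind.comp (fun (c : ψ.range) n => ENNReal.ofReal (1 - c) ^ n) fun _ => .of_discrete)
    (fun c => measurable_from_top.comp (h.measurable_count (hA c)))]
  have h1 : ∀ c : ψ.range, ∫⁻ ω, ENNReal.ofReal (1 - c) ^ count N x (A c) ω ∂μ =
      ENNReal.ofReal (Real.exp (-(Λ.real (A c) * c))) := fun c => by
    rw [(h.count_law _ (hA c)).lintegral_comp (f := fun n => ENNReal.ofReal (1 - c) ^ n)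
      Measurable.of_discrete.aemeasurable, lintegral_pow_poissonMeasure _ (by linarith [(hc c).2])]
    congr 2
    simp [Measure.real, ENNReal.toReal]
  simp_rw [h1]
  rw [← ENNReal.ofReal_prod_of_nonneg (fun _ _ => (Real.exp_pos _).le), ← Real.exp_sum,
    Finset.sum_neg_distrib, SimpleFunc.integral_eq_sum _ (ψ.integrable_of_isFiniteMeasure),
    ← Finset.sum_coe_sort ψ.range]
  rfl

theorem IsPoissonProcess.lintegral_prod [IsProbabilityMeasure μ] [IsFiniteMeasure Λ]
    (h : IsPoissonProcess μ Λ N x) {ψ : E → ℝ} (hm : Measurable ψ)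
    (hψ : ∀ e, ψ e ∈ Icc (0 : ℝ) 1) :
    ∫⁻ ω, ∏ i ∈ Finset.range (N ω), ENNReal.ofReal (1 - ψ (x i ω)) ∂μ =
      ENNReal.ofReal (Real.exp (-∫ e, ψ e ∂Λ)) := by
  let φ : ℕ → SimpleFunc E ℝ := SimpleFunc.approxOn ψ hm (Icc 0 1) 0 (by simp)
  have hφ : ∀ n e, φ n e ∈ Icc (0 : ℝ) 1 := fun n e => SimpleFunc.approxOn_mem hm _ n e
  have hlim : ∀ e, Tendsto (fun n => φ n e) atTop (𝓝 (ψ e)) := fun e =>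
    SimpleFunc.tendsto_approxOn hm _ (subset_closure (hψ e))
  have h1 : Tendsto (fun n => ∫⁻ ω, ∏ i ∈ Finset.range (N ω), ENNReal.ofReal (1 - φ n (x i ω)) ∂μ)
      atTop (𝓝 (∫⁻ ω, ∏ i ∈ Finset.range (N ω), ENNReal.ofReal (1 - ψ (x i ω)) ∂μ)) := by
    refine tendsto_lintegral_of_dominated_convergence (fun _ => 1) (fun n => ?_) (fun n => ?_)
      (by simp) ?_
    · refine measurable_countable_index
        (F := fun k ω => ∏ i ∈ Finset.range k, ENNReal.ofReal (1 - φ n (x i ω))) h.measurable_num fun k => Finset.measurable_fun_prod _ fun i _ => ?_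
      exact (measurable_const.sub ((φ n).measurable.comp (h.measurable_point i))).ennreal_ofReal
    · refine Eventually.of_forall fun ω => Finset.prod_le_one' fun i _ => ?_
      simpa using (hφ n _).1
    · refine Eventually.of_forall fun ω => ENNReal.tendsto_finsetProd_of_ne_top _ (fun i _ => ?_)
        fun i _ => by simp
      exact ENNReal.tendsto_ofReal ((hlim _).const_sub _)
  have h2 : Tendsto (fun n => ENNReal.ofReal (Real.exp (-∫ e, φ n e ∂Λ))) atTop
      (𝓝 (ENNReal.ofReal (Real.exp (-∫ e, ψ e ∂Λ)))) := by
    refine ENNReal.tendsto_ofReal ((Real.continuous_exp.tendsto _).comp (Tendsto.neg ?_))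
    refine tendsto_integral_of_dominated_convergence (fun _ => 1)
      (fun n => (φ n).measurable.aestronglyMeasurable) (by simp)
      (fun n => Eventually.of_forall fun e => ?_) (Eventually.of_forall hlim)
    rw [Real.norm_of_nonneg (hφ n e).1]
    exact (hφ n e).2
  refine tendsto_nhds_unique h1 (h2.congr fun n => ?_)
  rw [h.lintegral_prod_simpleFunc _ (hφ n)]

/-- Given the points, independence of the marks turns each factor into 1 minus the mark average of
ψ, which reduces the claim to the unmarked formula. -/
theorem IsPoissonProcess.lintegral_prod_marked {F : Type*} [MeasurableSpace F]
    [IsProbabilityMeasure μ] [IsFiniteMeasure Λ] (h : IsPoissonProcess μ Λ N x)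
    {m : ℕ → Ω → F} {κ : Measure F} [IsProbabilityMeasure κ] (hm : ∀ i, Measurable (m i))
    (hlaw : ∀ i, HasLaw (m i) κ μ) (hind : iIndepFun m μ)
    (hindp : IndepFun (fun ω i => m i ω) (fun ω => (N ω, fun i => x i ω)) μ)
    {ψ : E × F → ℝ} (hψm : Measurable ψ) (hψ : ∀ e, ψ e ∈ Icc (0 : ℝ) 1) :
    ∫⁻ ω, ∏ i ∈ Finset.range (N ω), ENNReal.ofReal (1 - ψ (x i ω, m i ω)) ∂μ =
      ENNReal.ofReal (Real.exp (-∫ e, ψ e ∂(Λ.prod κ))) := by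
  let Φ : (ℕ → F) × (ℕ × (ℕ → E)) → ℝ≥0∞ := fun p =>
    ∏ i ∈ Finset.range p.2.1, ENNReal.ofReal (1 - ψ (p.2.2 i, p.1 i))
  have hΦ : Measurable Φ := by
    refine measurable_countable_index (N := fun p : (ℕ → F) × (ℕ × (ℕ → E)) => p.2.1)
      (F := fun k p => ∏ i ∈ Finset.range k, ENNReal.ofReal (1 - ψ (p.2.2 i, p.1 i))) (by fun_prop)
      fun k => Finset.measurable_fun_prod _ fun i _ => ?_
    exact (measurable_const.sub (hψm.comp (by fun_prop))).ennreal_ofReal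
  have hM : Measurable fun ω i => m i ω := measurable_pi_lambda _ hm
  have hX : Measurable fun ω => (N ω, fun i => x i ω) :=
    h.measurable_num.prodMk (measurable_pi_lambda _ h.measurable_point)
  have hint : ∀ e, Integrable (fun f => ψ (e, f)) κ := fun e =>
    Integrable.of_mem_Icc 0 1 (hψm.comp (by fun_prop)).aemeasurable (Eventually.of_forall fun f => hψ _)
  have hinner : ∀ p : ℕ × (ℕ → E), ∫⁻ f, Φ (f, p) ∂(μ.map fun ω i => m i ω) =
      ∏ i ∈ Finset.range p.1, ENNReal.ofReal (1 - ∫ f, ψ (p.2 i, f) ∂κ) := fun p => by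
    rw [lintegral_map (f := fun f => Φ (f, p)) (hΦ.comp (by fun_prop)) hM]
    have hmeas : ∀ i, Measurable fun f => ENNReal.ofReal (1 - ψ (p.2 i, f)) := fun i =>
      (measurable_const.sub (hψm.comp (by fun_prop))).ennreal_ofReal
    change ∫⁻ ω, ∏ i ∈ Finset.range p.1, ENNReal.ofReal (1 - ψ (p.2 i, m i ω)) ∂μ = _
    rw [lintegral_prod_eq_prod_lintegral_of_indepFun _
      (fun i ω => ENNReal.ofReal (1 - ψ (p.2 i, m i ω)))
      (hind.comp (fun i f => ENNReal.ofReal (1 - ψ (p.2 i, f))) hmeas)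
      (fun i => (hmeas i).comp (hm i))]
    refine Finset.prod_congr rfl fun i _ => ?_
    rw [(hlaw i).lintegral_comp (f := fun f => ENNReal.ofReal (1 - ψ (p.2 i, f)))
      (hmeas i).aemeasurable, ← ofReal_integral_eq_lintegral_ofReal
      (f := fun f => 1 - ψ (p.2 i, f)) ((integrable_const _).sub (hint _))
      (Eventually.of_forall fun f => sub_nonneg.2 (hψ _).2), integral_sub (integrable_const _) (hint _)]
    simp
  calc ∫⁻ ω, ∏ i ∈ Finset.range (N ω), ENNReal.ofReal (1 - ψ (x i ω, m i ω)) ∂μ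
      = ∫⁻ p, Φ p ∂(μ.map fun ω => ((fun i => m i ω), (N ω, fun i => x i ω))) := by
        rw [lintegral_map hΦ (hM.prodMk hX)]
    _ = ∫⁻ p, ∫⁻ f, Φ (f, p) ∂(μ.map fun ω i => m i ω) ∂(μ.map fun ω => (N ω, fun i => x i ω)) := by
        have := Measure.isProbabilityMeasure_map (μ := μ) hM.aemeasurable
        have := Measure.isProbabilityMeasure_map (μ := μ) hX.aemeasurable
        rw [(indepFun_iff_map_prod_eq_prod_map_map hM.aemeasurable hX.aemeasurable).1 hindp,
          lintegral_prod_symm _ hΦ.aemeasurable]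
    _ = ∫⁻ ω, ∏ i ∈ Finset.range (N ω), ENNReal.ofReal (1 - ∫ f, ψ (x i ω, f) ∂κ) ∂μ := by
        rw [lintegral_map hΦ.lintegral_prod_left' hX]
        exact lintegral_congr fun ω => hinner _
    _ = _ := by
        have hsm : StronglyMeasurable fun e => ∫ f, ψ (e, f) ∂κ :=
          hψm.stronglyMeasurable.integral_prod_right'
        rw [h.lintegral_prod hsm.measurable fun e => ⟨integral_nonneg fun f => (hψ _).1, ?_⟩]
        · rw [integral_prod]
          exact Integrable.of_mem_Icc 0 1 hψm.aemeasurable (Eventually.of_forall hψ)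
        · simpa using integral_mono (hint e) (integrable_const 1) fun f => (hψ _).2

end Poisson

/-! ### Auxiliary integrals -/

/-- The integrand is minus the derivative of x ↦ exp(∫ h from x to c) wherever h is continuous.
Countably many exceptions are allowed because h will be built from a monotone quantile function. -/
theorem integral_mul_exp_integral {h : ℝ → ℝ} {a b c : ℝ} (hab : a ≤ b)
    (hm : Measurable h) (hi : ∀ x y, IntervalIntegrable h volume x y) {D : Set ℝ}
    (hD : D.Countable) (hc : ∀ x ∈ Ioo a b \ D, ContinuousAt h x) :
    ∫ x in a..b, h x * Real.exp (∫ y in x..c, h y) =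
      Real.exp (∫ y in a..c, h y) - Real.exp (∫ y in b..c, h y) := by
  have hcont : Continuous fun x => Real.exp (∫ y in x..c, h y) := by
    refine Real.continuous_exp.comp ?_
    simp_rw [intervalIntegral.integral_symm c]
    exact (intervalIntegral.continuous_primitive hi c).neg
  have := integral_eq_of_hasDerivAt_off_countable_of_le
    (fun x => -Real.exp (∫ y in x..c, h y)) (fun x => h x * Real.exp (∫ y in x..c, h y)) hab hD
    hcont.neg.continuousOn (fun x hx => ?_) ((hi a b).mul_continuousOn hcont.continuousOn)
  · rw [this]; ring
  · have := intervalIntegral.integral_hasDerivAt_left (hi x c)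
      (hm.stronglyMeasurable.stronglyMeasurableAtFilter) (hc x hx)
    exact this.exp.neg.congr_deriv (by ring)

theorem lintegral_exp_neg_mul {T : ℝ} (hT : 0 < T) :
    ∫⁻ s in Ioi 0, ENNReal.ofReal (Real.exp (-(s * T))) = ENNReal.ofReal T⁻¹ := by
  have hi : IntegrableOn (fun s : ℝ => Real.exp (-T * s)) (Ioi 0) :=
    integrableOn_exp_mul_Ioi (by linarith) 0
  have h : ∀ s : ℝ, -(s * T) = -T * s := fun s => by ring
  simp_rw [h]
  rw [← ofReal_integral_eq_lintegral_ofReal hi (Eventually.of_forall fun s => (Real.exp_pos _).le),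
    integral_exp_mul_Ioi (by linarith)]
  simp

/-- The weight `w` with `log (1 + 1 / T) = ∫ w s * exp (- s T) ds`. -/
noncomputable def logWeight (s : ℝ) : ℝ≥0∞ :=
  ∫⁻ t in Ioc (0 : ℝ) 1, ENNReal.ofReal (Real.exp (-(s * t)))

theorem measurable_logWeight : Measurable logWeight := by
  unfold logWeight
  exact Measurable.lintegral_prod_right'
    (f := fun p : ℝ × ℝ => ENNReal.ofReal (Real.exp (-(p.1 * p.2)))) (by fun_prop)

theorem logWeight_le_one {s : ℝ} (hs : 0 ≤ s) : logWeight s ≤ 1 := by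
  calc logWeight s ≤ ∫⁻ t in Ioc (0 : ℝ) 1, 1 := by
        refine setLIntegral_mono measurable_const fun t ht => ?_
        simpa using mul_nonneg hs ht.1.le
    _ = 1 := by simp

theorem logWeight_le_inv {s : ℝ} (hs : 0 < s) : logWeight s ≤ ENNReal.ofReal s⁻¹ := by
  calc logWeight s ≤ ∫⁻ t in Ioi (0 : ℝ), ENNReal.ofReal (Real.exp (-(t * s))) := by
        simp_rw [mul_comm _ s]
        exact lintegral_mono_set Ioc_subset_Ioi_self
    _ = _ := lintegral_exp_neg_mul hs

/-- By Tonelli the left side is the integral of 1/(t + T) over 0 < t ≤ 1. -/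
theorem lintegral_logWeight_mul {T : ℝ} (hT : 0 < T) :
    ∫⁻ s in Ioi 0, logWeight s * ENNReal.ofReal (Real.exp (-(s * T))) =
      ENNReal.ofReal (Real.log (1 + T⁻¹)) := by
  have h1 : ∀ s, logWeight s * ENNReal.ofReal (Real.exp (-(s * T))) =
      ∫⁻ t in Ioc (0 : ℝ) 1, ENNReal.ofReal (Real.exp (-(s * (t + T)))) := fun s => by
    rw [logWeight, ← lintegral_mul_const _ (by fun_prop)]
    refine lintegral_congr fun t => ?_
    rw [← ENNReal.ofReal_mul (Real.exp_pos _).le, ← Real.exp_add]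
    ring_nf
  simp_rw [h1]
  rw [lintegral_lintegral_swap (by fun_prop)]
  have h2 : ∫⁻ t in Ioc (0 : ℝ) 1, ∫⁻ s in Ioi 0, ENNReal.ofReal (Real.exp (-(s * (t + T)))) =
      ∫⁻ t in Ioc (0 : ℝ) 1, ENNReal.ofReal (t + T)⁻¹ :=
    setLIntegral_congr_fun measurableSet_Ioc fun t ht =>
      lintegral_exp_neg_mul (by linarith [ht.1])
  have hi : IntegrableOn (fun t : ℝ => (t + T)⁻¹) (Ioc 0 1) := by
    refine (ContinuousOn.integrableOn_Icc ?_).mono_set Ioc_subset_Icc_self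
    exact ContinuousOn.inv₀ (by fun_prop) fun t ht => by linarith [ht.1]
  rw [h2, ← ofReal_integral_eq_lintegral_ofReal hi, ← intervalIntegral.integral_of_le zero_le_one,
    intervalIntegral.integral_comp_add_right (fun t => t⁻¹), integral_inv_of_pos (by linarith)
    (by linarith)]
  · congr 2
    field_simp
    ring
  · filter_upwards [ae_restrict_mem measurableSet_Ioc] with t ht
    have := ht.1
    simp only [Pi.zero_apply]; positivity

/-! ### Replacing a frozen parameter by a random one -/

section Ceil

variable {X Y : Type*} [MeasurableSpace X] [MeasurableSpace Y]

theorem setLIntegral_ceil_div {μ : Measure X} {f : X → ℝ} (hf : Measurable f)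
    (Φ : ℝ → X → ℝ≥0∞) {n : ℕ} (hn : 0 < n) :
    ∫⁻ x in f ⁻¹' Ioi 0, Φ (⌈n * f x⌉₊ / n) x ∂μ =
      ∑' k : ℕ, ∫⁻ x in f ⁻¹' Ioc (k / n) ((k + 1 : ℕ) / n), Φ ((k + 1 : ℕ) / n) x ∂μ := by
  have hn' : (0 : ℝ) < n := by exact_mod_cast hn
  have hceil : ∀ (k : ℕ) (r : ℝ), r ∈ Ioc (k / n : ℝ) ((k + 1 : ℕ) / n) ↔ ⌈n * r⌉₊ = k + 1 := by
    intro k r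
    rw [Nat.ceil_eq_iff (by omega), mem_Ioc, div_lt_iff₀' hn', le_div_iff₀' hn']
    simp
  have hU : f ⁻¹' Ioi 0 = ⋃ k : ℕ, f ⁻¹' Ioc (k / n) ((k + 1 : ℕ) / n) := by
    ext x
    simp only [mem_preimage, mem_iUnion, hceil]
    refine ⟨fun hx => ?_, fun ⟨k, hk⟩ => ?_⟩
    · have : 0 < ⌈n * f x⌉₊ := Nat.ceil_pos.2 (mul_pos hn' hx)
      exact ⟨⌈n * f x⌉₊ - 1, by omega⟩
    · have : 0 < ⌈n * f x⌉₊ := by omega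
      exact (mul_pos_iff_of_pos_left hn').1 (Nat.ceil_pos.1 this)
  rw [hU, lintegral_iUnion (fun k => hf measurableSet_Ioc)]
  · congr 1 with k
    refine setLIntegral_congr_fun (hf measurableSet_Ioc) fun x hx => ?_
    simp only [(hceil k (f x)).1 hx]
  · intro j k hjk
    refine disjoint_left.2 fun x hj hk => hjk ?_
    have := (hceil _ _).1 hj
    have := (hceil _ _).1 hk
    omega

theorem tendsto_setLIntegral_ceil_div {μ : Measure X} [IsFiniteMeasure μ] {f : X → ℝ}
    (hf : Measurable f) {Φ : ℝ → X → ℝ≥0∞} (hΦ : Measurable (Function.uncurry Φ)) {C : ℝ≥0∞}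
    (hC : C ≠ ⊤) (hb : ∀ᵐ x ∂μ, ∀ r, 0 < r → Φ r x ≤ C)
    (hc : ∀ᵐ x ∂μ, ∀ r, 0 < r → ContinuousAt (fun r => Φ r x) r) :
    Tendsto (fun n : ℕ => ∫⁻ x in f ⁻¹' Ioi 0, Φ (⌈n * f x⌉₊ / n) x ∂μ) atTop
      (𝓝 (∫⁻ x in f ⁻¹' Ioi 0, Φ (f x) x ∂μ)) := by
  have hfp := ae_restrict_mem (μ := μ) (hf measurableSet_Ioi : MeasurableSet (f ⁻¹' Ioi 0))
  -- The index is shifted because n = 0 would give the parameter 0, where the bound is not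
  -- available.
  refine (tendsto_add_atTop_iff_nat 1).1 (tendsto_lintegral_of_dominated_convergence (fun _ => C)
    (fun n => ?_) (fun n => ?_) ?_ ?_)
  · have : Measurable fun x => ((⌈((n + 1 : ℕ) : ℝ) * f x⌉₊ : ℕ) : ℝ) / (n + 1 : ℕ) :=
      (measurable_from_top.comp (Nat.measurable_ceil.comp (hf.const_mul _))).div_const _
    exact hΦ.comp (this.prodMk measurable_id)
  · filter_upwards [ae_restrict_of_ae hb, hfp] with x hx hxp
    have : 0 < ⌈((n + 1 : ℕ) : ℝ) * f x⌉₊ := Nat.ceil_pos.2 (mul_pos (by positivity) hxp)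
    exact hx _ (by positivity)
  · simp only [lintegral_const]
    exact ENNReal.mul_ne_top hC (measure_ne_top _ _)
  · filter_upwards [ae_restrict_of_ae hc, hfp] with x hx (hxp : 0 < f x)
    refine (hx _ hxp).tendsto.comp ?_
    have := (tendsto_nat_ceil_mul_div_atTop hxp.le).comp
      ((tendsto_natCast_atTop_atTop (R := ℝ)).comp (tendsto_add_atTop_nat 1))
    simpa [Function.comp_def, mul_comm] using this

/-- A disintegration by discretization: rounding f and g up to multiples of 1/n makes the parameter
constant on each level block, where the hypothesis applies, and continuity in r lets n tend to ∞. -/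
theorem setLIntegral_eq_of_Ioc {μ : Measure X} {ν : Measure Y} [IsFiniteMeasure μ]
    [IsFiniteMeasure ν] {f : X → ℝ} {g : Y → ℝ} (hf : Measurable f) (hg : Measurable g)
    {Φ : ℝ → X → ℝ≥0∞} {Ψ : ℝ → Y → ℝ≥0∞} (hΦ : Measurable (Function.uncurry Φ))
    (hΨ : Measurable (Function.uncurry Ψ)) {C : ℝ≥0∞} (hC : C ≠ ⊤)
    (hΦb : ∀ᵐ x ∂μ, ∀ r, 0 < r → Φ r x ≤ C) (hΨb : ∀ᵐ x ∂ν, ∀ r, 0 < r → Ψ r x ≤ C)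
    (hΦc : ∀ᵐ x ∂μ, ∀ r, 0 < r → ContinuousAt (fun r => Φ r x) r)
    (hΨc : ∀ᵐ x ∂ν, ∀ r, 0 < r → ContinuousAt (fun r => Ψ r x) r)
    (h : ∀ r a b, 0 < r → 0 ≤ a → a ≤ b →
      ∫⁻ x in f ⁻¹' Ioc a b, Φ r x ∂μ = ∫⁻ y in g ⁻¹' Ioc a b, Ψ r y ∂ν) :
    ∫⁻ x in f ⁻¹' Ioi 0, Φ (f x) x ∂μ = ∫⁻ y in g ⁻¹' Ioi 0, Ψ (g y) y ∂ν := by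
  refine tendsto_nhds_unique (tendsto_setLIntegral_ceil_div hf hΦ hC hΦb hΦc)
    ((tendsto_setLIntegral_ceil_div hg hΨ hC hΨb hΨc).congr' ?_)
  filter_upwards [eventually_gt_atTop 0] with n hn
  rw [setLIntegral_ceil_div hf Φ hn, setLIntegral_ceil_div hg Ψ hn]
  congr 1 with k
  refine (h _ _ _ (by positivity) (by positivity) ?_).symm
  gcongr
  simp

end Ceil

/-! ### Joint law of the sum and the maximum of a Poisson process on the half-line -/

section Kernel

/-- The value of `𝔼(exp (-s / SINR); SINR > 0)` in a network with noise `W` and `Λ` nodes on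
average, where `G` is the upper quantile function of the power received from a random node. -/
noncomputable def sinrLaplace (G : ℝ → ℝ) (W Λ s : ℝ) : ℝ≥0∞ :=
  ∫⁻ x in G ⁻¹' Ioi 0 ∩ Ioo 0 1, ENNReal.ofReal (Λ * Real.exp (-(s * W / G x)) *
    Real.exp (-(Λ * (1 - ∫ y in x..1, Real.exp (-(s / G x * G y))))))

theorem measurable_integral_exp {G : ℝ → ℝ} (hG : Measurable G) :
    Measurable fun p : ℝ × ℝ => ∫ y in p.2..1, Real.exp (-(p.1 * G y)) := by
  have key : ∀ s : Set ((ℝ × ℝ) × ℝ), MeasurableSet s →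
      Measurable fun p : ℝ × ℝ => ∫ y in {y | (p, y) ∈ s}, Real.exp (-(p.1 * G y)) := by
    intro s hs
    have h1 : StronglyMeasurable fun q : (ℝ × ℝ) × ℝ =>
        s.indicator (fun q => Real.exp (-(q.1.1 * G q.2))) q :=
      (Measurable.indicator (by fun_prop) hs).stronglyMeasurable
    convert (h1.integral_prod_right' (ν := volume)).measurable using 2 with p
    exact (integral_indicator (hs.preimage measurable_prodMk_left)).symm
  -- The interval integral is the integral over (p.2, 1] minus the one over (1, p.2], one of which
  -- is empty.
  have h1 := key ({q | q.1.2 < q.2} ∩ {q | q.2 ≤ 1})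
    ((measurableSet_lt (by fun_prop) (by fun_prop)).inter
      (measurableSet_le (by fun_prop) (by fun_prop)))
  have h2 := key ({q | 1 < q.2} ∩ {q | q.2 ≤ q.1.2})
    ((measurableSet_lt (by fun_prop) (by fun_prop)).inter
      (measurableSet_le (by fun_prop) (by fun_prop)))
  exact h1.sub h2

theorem exp_neg_mul_le_one {σ g : ℝ} (hσ : 0 ≤ σ) (hg : 0 ≤ g) : Real.exp (-(σ * g)) ≤ 1 := by
  simpa using mul_nonneg hσ hg

theorem intervalIntegrable_exp {G : ℝ → ℝ} (hG : Measurable G) (hG0 : ∀ x, 0 ≤ G x) {σ : ℝ}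
    (hσ : 0 ≤ σ) (a b : ℝ) : IntervalIntegrable (fun y => Real.exp (-(σ * G y))) volume a b := by
  refine (intervalIntegrable_const (c := (1 : ℝ))).mono_fun (by fun_prop)
    (Eventually.of_forall fun y => ?_)
  dsimp only
  rw [Real.norm_of_nonneg (Real.exp_pos _).le]
  simpa using mul_nonneg hσ (hG0 y)

theorem integral_exp_mem_Icc {G : ℝ → ℝ} (hG : Measurable G) (hG0 : ∀ x, 0 ≤ G x) {σ : ℝ}
    (hσ : 0 ≤ σ) {a b : ℝ} (hab : a ≤ b) :
    ∫ y in a..b, Real.exp (-(σ * G y)) ∈ Icc 0 (b - a) := by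
  refine ⟨intervalIntegral.integral_nonneg hab fun y _ => (Real.exp_pos _).le, ?_⟩
  have := intervalIntegral.integral_mono hab (intervalIntegrable_exp hG hG0 hσ a b)
    (intervalIntegrable_const (c := (1 : ℝ))) fun y => exp_neg_mul_le_one hσ (hG0 y)
  simpa using this

theorem continuousAt_integral_exp {G : ℝ → ℝ} (hG : Measurable G) (hG0 : ∀ x, 0 ≤ G x) {σ : ℝ}
    (hσ : 0 < σ) (a b : ℝ) :
    ContinuousAt (fun σ => ∫ y in a..b, Real.exp (-(σ * G y))) σ := by
  refine intervalIntegral.continuousAt_of_dominated_interval (bound := fun _ => 1)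
    (Eventually.of_forall fun τ => by fun_prop) ?_ intervalIntegrable_const
    (Eventually.of_forall fun y _ => by fun_prop)
  filter_upwards [eventually_gt_nhds hσ] with τ hτ
  refine Eventually.of_forall fun y _ => ?_
  rw [Real.norm_of_nonneg (Real.exp_pos _).le]
  exact exp_neg_mul_le_one hτ.le (hG0 y)

/-- Up to a null set, the levels a < G(x) ≤ b correspond to x between the tails at b and at a. On
that interval the integrand is a total derivative. -/
theorem setLIntegral_quantile_Ioc {π : Measure ℝ} [IsProbabilityMeasure π] {Λ σ a b : ℝ}
    (hΛ : 0 ≤ Λ) (hσ : 0 ≤ σ) (ha : 0 ≤ a) (hab : a ≤ b) :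
    ∫⁻ x in quantile π ⁻¹' Ioc a b, ENNReal.ofReal (Λ * Real.exp (-(σ * quantile π x)) *
        Real.exp (-(Λ * (1 - ∫ y in x..1, Real.exp (-(σ * quantile π y))))))
        ∂(volume.restrict (Ioo 0 1)) =
      ENNReal.ofReal (
        Real.exp (-(Λ * (1 - ∫ y in (π.real (Ioi b))..1, Real.exp (-(σ * quantile π y))))) -
        Real.exp (-(Λ * (1 - ∫ y in (π.real (Ioi a))..1, Real.exp (-(σ * quantile π y)))))) := by
  set G := quantile π
  have hG : Measurable G := measurable_quantile
  have hG0 : ∀ x, 0 ≤ G x := quantile_nonneg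
  have hi := intervalIntegrable_exp hG hG0 hσ
  have hset : (volume.restrict (Ioo 0 1)).restrict (G ⁻¹' Ioc a b) =
      volume.restrict (Ioc (π.real (Ioi b)) (π.real (Ioi a))) := by
    rw [Measure.restrict_restrict (hG measurableSet_Ioc)]
    refine Measure.restrict_congr_set ?_
    have hne : ∀ c : ℝ, ∀ᵐ x, x ≠ c := fun c => by simp [ae_iff]
    filter_upwards [hne (π.real (Ioi b)), hne (π.real (Ioi a)), hne 0, hne 1] with x h1 h2 h3 h4
    apply propext
    change x ∈ G ⁻¹' Ioc a b ∩ Ioo 0 1 ↔ x ∈ Ioc (π.real (Ioi b)) (π.real (Ioi a))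
    have hb : 0 ≤ π.real (Ioi b) := measureReal_nonneg
    have ha1 : π.real (Ioi a) ≤ 1 := measureReal_le_one
    constructor
    · rintro ⟨⟨h5, h6⟩, h7⟩
      exact ⟨lt_of_le_of_ne ((quantile_le_iff h7.1 (ha.trans hab)).1 h6) h1.symm,
        ((lt_quantile_iff h7.1 ha).1 h5).le⟩
    · rintro ⟨h5, h6⟩
      have hx : 0 < x := hb.trans_lt h5
      exact ⟨⟨(lt_quantile_iff hx ha).2 (lt_of_le_of_ne h6 h2),
        (quantile_le_iff hx (ha.trans hab)).2 h5.le⟩, hx, lt_of_le_of_ne (h6.trans ha1) h4⟩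
  have htail : π.real (Ioi b) ≤ π.real (Ioi a) := antitone_measureReal_Ioi hab
  have hcongr : ∀ x, Λ * Real.exp (-(σ * G x)) *
      Real.exp (-(Λ * (1 - ∫ y in x..1, Real.exp (-(σ * G y))))) = Real.exp (-Λ) *
        (Λ * Real.exp (-(σ * G x)) * Real.exp (∫ y in x..1, Λ * Real.exp (-(σ * G y)))) := by
    intro x
    rw [intervalIntegral.integral_const_mul, show -(Λ * (1 - ∫ y in x..1, Real.exp (-(σ * G y)))) =
      -Λ + Λ * ∫ y in x..1, Real.exp (-(σ * G y)) by ring, Real.exp_add]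
    ring
  have hcont : Continuous fun x => Real.exp (∫ y in x..1, Λ * Real.exp (-(σ * G y))) := by
    refine Real.continuous_exp.comp ?_
    simp_rw [intervalIntegral.integral_symm 1]
    exact (intervalIntegral.continuous_primitive (fun a b => (hi a b).const_mul Λ) 1).neg
  have hint : IntervalIntegrable (fun x => Real.exp (-Λ) *
        (Λ * Real.exp (-(σ * G x)) * Real.exp (∫ y in x..1, Λ * Real.exp (-(σ * G y)))))
        volume (π.real (Ioi b)) (π.real (Ioi a)) :=
    (((hi _ _).const_mul Λ).mul_continuousOn hcont.continuousOn).const_mul _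
  rw [hset]
  simp_rw [hcongr]
  rw [← ofReal_integral_eq_lintegral_ofReal ((intervalIntegrable_iff_integrableOn_Ioc_of_le htail).1 hint)
    (Eventually.of_forall fun x => by simp only [Pi.zero_apply]; positivity),
    ← intervalIntegral.integral_of_le htail, intervalIntegral.integral_const_mul,
    integral_mul_exp_integral (D := {x | x ∈ Ioi 0 ∧ ¬ ContinuousWithinAt G (Ioi 0) x}) htail
      (by fun_prop) (fun x y => (hi x y).const_mul Λ) ?_ ?_]
  · congr 1
    simp_rw [intervalIntegral.integral_const_mul, mul_sub, ← Real.exp_add]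
    ring_nf
  · exact antitoneOn_quantile.countable_not_continuousWithinAt
  · rintro x ⟨hx, hxD⟩
    have hx0 : 0 < x := measureReal_nonneg.trans_lt hx.1
    have : ContinuousAt G x := by
      by_contra hcon
      exact hxD ⟨hx0, fun h => hcon (h.continuousAt (Ioi_mem_nhds hx0))⟩
    fun_prop

/-- Differences of the hypothesis at two levels give the Laplace transform of S on {a < M ≤ b} for
each fixed σ. Choosing σ = s/r and then letting r be the maximum itself, by
`setLIntegral_eq_of_Ioc`, yields the joint transform. -/
theorem setLIntegral_exp_div_max {Ω : Type*} [MeasurableSpace Ω] {μ : Measure Ω}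
    [IsProbabilityMeasure μ] {π : Measure ℝ} [IsProbabilityMeasure π] {S M : Ω → ℝ}
    (hS : Measurable S) (hM : Measurable M) (hS0 : ∀ᵐ ω ∂μ, 0 ≤ S ω) {Λ : ℝ} (hΛ : 0 ≤ Λ)
    (h : ∀ σ p : ℝ, 0 < σ → 0 ≤ p →
      ∫⁻ ω in M ⁻¹' Iic p, ENNReal.ofReal (Real.exp (-(σ * S ω))) ∂μ = ENNReal.ofReal
        (Real.exp (-(Λ * (1 - ∫ y in (π.real (Ioi p))..1, Real.exp (-(σ * quantile π y)))))))
    {W : ℝ} (hW : 0 ≤ W) {s : ℝ} (hs : 0 < s) :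
    ∫⁻ ω in M ⁻¹' Ioi 0, ENNReal.ofReal (Real.exp (-(s * ((S ω - M ω + W) / M ω)))) ∂μ =
      sinrLaplace (quantile π) W Λ s := by
  set G := quantile π
  have hG : Measurable G := measurable_quantile
  have hG0 : ∀ x, 0 ≤ G x := quantile_nonneg
  let Φ : ℝ → Ω → ℝ≥0∞ := fun r ω =>
    ENNReal.ofReal (Real.exp (-(s * W / r))) * ENNReal.ofReal (Real.exp (-(s / r * S ω)))
  let Ψ : ℝ → ℝ → ℝ≥0∞ := fun r x =>
    ENNReal.ofReal (Real.exp (-(s * W / r))) * ENNReal.ofReal (Λ * Real.exp (-(s / r * G x)) *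
      Real.exp (-(Λ * (1 - ∫ y in x..1, Real.exp (-(s / r * G y))))))
  have hmain : ∫⁻ ω in M ⁻¹' Ioi 0, Φ (M ω) ω ∂μ =
      ∫⁻ x in G ⁻¹' Ioi 0, Ψ (G x) x ∂(volume.restrict (Ioo 0 1)) := by
    have hfac : ∀ r : ℝ, 0 < r → ENNReal.ofReal (Real.exp (-(s * W / r))) ≤ 1 := fun r hr => by
      simpa using by positivity
    -- Φ is bounded by 1 and Ψ by Λ.
    refine setLIntegral_eq_of_Ioc (C := max 1 (ENNReal.ofReal Λ)) hM hG ?_ ?_ ?_ ?_ ?_ ?_ ?_ ?_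
    · have : Measurable fun p : ℝ × Ω => ENNReal.ofReal (Real.exp (-(s * W / p.1))) *
        ENNReal.ofReal (Real.exp (-(s / p.1 * S p.2))) := by fun_prop
      exact this
    · have h1 : Measurable fun p : ℝ × ℝ => ∫ y in p.2..1, Real.exp (-(s / p.1 * G y)) :=
        (measurable_integral_exp hG).comp (f := fun p : ℝ × ℝ => (s / p.1, p.2)) (by fun_prop)
      have : Measurable fun p : ℝ × ℝ => ENNReal.ofReal (Real.exp (-(s * W / p.1))) *
        ENNReal.ofReal (Λ * Real.exp (-(s / p.1 * G p.2)) *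
          Real.exp (-(Λ * (1 - ∫ y in p.2..1, Real.exp (-(s / p.1 * G y)))))) := by fun_prop
      exact this
    · simp
    · filter_upwards [hS0] with ω hω r hr
      refine (mul_le_one' (hfac r hr) ?_).trans (le_max_left _ _)
      simpa using by positivity
    · filter_upwards [ae_restrict_mem measurableSet_Ioo] with x hx r hr
      have h1 := exp_neg_mul_le_one (div_pos hs hr).le (hG0 x)
      have h2 := integral_exp_mem_Icc hG hG0 (div_pos hs hr).le hx.2.le
      have h3 : Real.exp (-(Λ * (1 - ∫ y in x..1, Real.exp (-(s / r * G y))))) ≤ 1 := by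
        have : 0 ≤ Λ * (1 - ∫ y in x..1, Real.exp (-(s / r * G y))) :=
          mul_nonneg hΛ (by linarith [h2.2, hx.1])
        simpa using this
      calc Ψ r x ≤ 1 * ENNReal.ofReal (Λ * 1 * 1) := by
            refine mul_le_mul' (hfac r hr) (ENNReal.ofReal_le_ofReal ?_)
            gcongr
        _ ≤ _ := by simp
    · refine Eventually.of_forall fun ω r hr => ?_
      have hr' := hr.ne'
      refine ENNReal.Tendsto.mul ?_ (Or.inr (by simp)) ?_ (Or.inr (by simp))
      · exact ENNReal.continuous_ofReal.continuousAt.comp (f := fun r => Real.exp (-(s * W / r)))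
          (by fun_prop (disch := assumption))
      · exact ENNReal.continuous_ofReal.continuousAt.comp (f := fun r => Real.exp (-(s / r * S ω)))
          (by fun_prop (disch := assumption))
    · refine Eventually.of_forall fun x r hr => ?_
      have hr' := hr.ne'
      have h1 : ContinuousAt (fun r => ∫ y in x..1, Real.exp (-(s / r * G y))) r :=
        (continuousAt_integral_exp hG hG0 (div_pos hs hr) x 1).comp (f := fun r => s / r)
          (by fun_prop (disch := assumption))
      refine ENNReal.Tendsto.mul ?_ (Or.inr (by simp)) ?_ (Or.inr (by simp))
      · exact ENNReal.continuous_ofReal.continuousAt.comp (f := fun r => Real.exp (-(s * W / r)))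
          (by fun_prop (disch := assumption))
      · exact ENNReal.continuous_ofReal.continuousAt.comp (f := fun r => Λ * Real.exp (-(s / r * G x)) *
          Real.exp (-(Λ * (1 - ∫ y in x..1, Real.exp (-(s / r * G y))))))
          (by fun_prop (disch := assumption))
    · intro r a b hr ha hab
      have hσ := div_pos hs hr
      rw [lintegral_const_mul _ (by fun_prop), lintegral_const_mul' _ _ (by simp),
        setLIntegral_quantile_Ioc hΛ hσ.le ha hab, ENNReal.ofReal_sub _ (Real.exp_pos _).le,
        ← h _ a hσ ha, ← h _ b hσ (ha.trans hab), ← Iic_union_Ioc_eq_Iic hab, preimage_union,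
        lintegral_union (hM measurableSet_Ioc)
          (Disjoint.preimage _ (Iic_disjoint_Ioc le_rfl)), ENNReal.add_sub_cancel_left]
      rw [h _ a hσ ha]
      exact ENNReal.ofReal_ne_top
  -- The factor exp(s) removes the strongest node's own contribution to S/M; in `hR` it cancels the
  -- factor exp(-(s/r) G(x)) at r = G(x).
  have hL : ∀ ω ∈ M ⁻¹' Ioi 0, ENNReal.ofReal (Real.exp (-(s * ((S ω - M ω + W) / M ω)))) =
      ENNReal.ofReal (Real.exp s) * Φ (M ω) ω := by
    intro ω (hω : 0 < M ω)
    simp only [Φ]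
    rw [← ENNReal.ofReal_mul (by positivity), ← ENNReal.ofReal_mul (by positivity), ← Real.exp_add,
      ← Real.exp_add]
    congr 2
    field_simp
    ring
  have hR : ∀ x ∈ G ⁻¹' Ioi 0, ENNReal.ofReal (Λ * Real.exp (-(s * W / G x)) *
      Real.exp (-(Λ * (1 - ∫ y in x..1, Real.exp (-(s / G x * G y)))))) =
      ENNReal.ofReal (Real.exp s) * Ψ (G x) x := by
    intro x (hx : 0 < G x)
    simp only [Ψ]
    rw [← ENNReal.ofReal_mul (by positivity), ← ENNReal.ofReal_mul (by positivity)]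
    congr 1
    rw [div_mul_cancel₀ s hx.ne', Real.exp_neg s]
    field_simp
  rw [setLIntegral_congr_fun (hM measurableSet_Ioi) hL, lintegral_const_mul' _ _ (by simp), hmain,
    sinrLaplace, ← Measure.restrict_restrict (hG measurableSet_Ioi),
    setLIntegral_congr_fun (hG measurableSet_Ioi) hR, lintegral_const_mul' _ _ (by simp)]

end Kernel

/-! ### The power received from a random node -/

namespace Pathloss

variable {d : ℕ} (L : Pathloss d)

theorem Rinf_pos : 0 < L.Rinf := by
  have h : ∀ k, k < L.K → 0 < L.R (k + 1) := by
    intro k hk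
    induction k with
    | zero => simpa [L.R_zero] using L.R_lt 0 hk
    | succ k ih => exact (ih (by omega)).trans (L.R_lt _ hk)
  have := L.one_le_K
  simpa [Rinf, Nat.sub_add_cancel this] using h (L.K - 1) (by omega)

theorem measurable_l : Measurable L.l :=
  Finset.measurable_fun_sum _ fun _ _ => Measurable.indicator (by fun_prop) measurableSet_Ico

theorem l_nonneg {r : ℝ} (hr : 0 ≤ r) : 0 ≤ L.l r :=
  Finset.sum_nonneg fun k hk => indicator_apply_nonneg fun _ =>
    mul_nonneg (L.A_pos k (Finset.mem_range.1 hk)).le (Real.rpow_nonneg hr _)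

end Pathloss

namespace Network

variable {d : ℕ} (net : Network d)

instance : IsProbabilityMeasure net.chan := net.chan_prob

theorem measureReal_domain_pos : 0 < volume.real net.domain :=
  ENNReal.toReal_pos (Metric.measure_ball_pos _ _ net.pathloss.Rinf_pos).ne' measure_ball_lt_top.ne

theorem isProbabilityMeasure_cond_domain : IsProbabilityMeasure (volume[|net.domain]) :=
  cond_isProbabilityMeasure_of_finite (Metric.measure_ball_pos _ _ net.pathloss.Rinf_pos).ne'
    measure_ball_lt_top.ne

instance : IsProbabilityMeasure net.nodeLaw := by
  have := net.isProbabilityMeasure_cond_domain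
  unfold nodeLaw
  infer_instance

theorem measurable_power : Measurable fun p : EuclideanSpace ℝ (Fin d) × ℝ => net.power p.1 p.2 :=
  measurable_snd.div (net.pathloss.measurable_l.comp (by fun_prop))

theorem power_nonneg (x : EuclideanSpace ℝ (Fin d)) {m : ℝ} (hm : 0 ≤ m) : 0 ≤ net.power x m :=
  div_nonneg hm (net.pathloss.l_nonneg (norm_nonneg x))

/-- The law of the power received from a random node. -/
noncomputable def powerLaw : Measure ℝ := net.nodeLaw.map fun p => net.power p.1 p.2

instance : IsProbabilityMeasure net.powerLaw :=
  Measure.isProbabilityMeasure_map net.measurable_power.aemeasurable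

theorem tail_eq : net.tail = fun t => net.powerLaw.real (Ioi t) := by
  ext t
  rw [tail, powerLaw, map_measureReal_apply net.measurable_power measurableSet_Ioi]
  rfl

theorem powerLaw_Iio_zero : net.powerLaw (Iio 0) = 0 := by
  rw [powerLaw, Measure.map_apply net.measurable_power measurableSet_Iio]
  have := net.isProbabilityMeasure_cond_domain
  have h : ∀ᵐ p ∂net.nodeLaw, 0 ≤ p.2 := Measure.quasiMeasurePreserving_snd.ae net.chan_nonneg
  refine measure_mono_null (fun p hp => ?_) h
  exact fun hp2 => (not_lt.2 (net.power_nonneg p.1 hp2)) hp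

theorem meanPower_eq :
    net.meanPower = ∫⁻ x in Ioo 0 1, ENNReal.ofReal (quantile net.powerLaw x) := by
  rw [← lintegral_map (f := ENNReal.ofReal) ENNReal.measurable_ofReal measurable_quantile,
    map_quantile net.powerLaw_Iio_zero, powerLaw,
    lintegral_map ENNReal.measurable_ofReal net.measurable_power]
  rfl

theorem integral_nodeLaw_power {f : ℝ → ℝ} (hf : Measurable f) :
    ∫ p, f (net.power p.1 p.2) ∂net.nodeLaw =
      ∫ x in Ioo 0 1, f (quantile net.powerLaw x) := by
  rw [← integral_map (φ := fun p : EuclideanSpace ℝ (Fin d) × ℝ => net.power p.1 p.2)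
    net.measurable_power.aemeasurable hf.aestronglyMeasurable,
    ← integral_map (φ := quantile net.powerLaw) measurable_quantile.aemeasurable
      hf.aestronglyMeasurable, map_quantile net.powerLaw_Iio_zero]
  rfl

end Network

/-! ### The signal quality of a realization -/

namespace Realization

variable {d : ℕ} {net : Network d} {lam : ℝ≥0}

attribute [local instance] Realization.mΩ Realization.prob

/-- The total power received from all nodes. -/
noncomputable def totalPower (Ξ : Realization net lam) (ω : Ξ.Ω) : ℝ :=
  ∑ i ∈ Finset.range (Ξ.N ω), Ξ.P i ω

/-- The largest power received from a node. -/
noncomputable def maxPower (Ξ : Realization net lam) (ω : Ξ.Ω) : ℝ :=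
  ⨆ i : Fin (Ξ.N ω), Ξ.P i ω

variable (Ξ : Realization net lam)

theorem measurable_P (i : ℕ) : Measurable (Ξ.P i) :=
  net.measurable_power.comp ((Ξ.poisson.measurable_point i).prodMk (Ξ.measurable_mark i))

theorem measurable_totalPower : Measurable Ξ.totalPower :=
  measurable_countable_index (F := fun n ω => ∑ i ∈ Finset.range n, Ξ.P i ω)
    Ξ.poisson.measurable_num fun _ => Finset.measurable_fun_sum _ fun i _ => Ξ.measurable_P i

theorem measurable_maxPower : Measurable Ξ.maxPower :=
  measurable_countable_index (F := fun n ω => ⨆ i : Fin n, Ξ.P i ω)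
    Ξ.poisson.measurable_num fun _ => Measurable.iSup fun i => Ξ.measurable_P i

theorem ae_P_nonneg : ∀ᵐ ω ∂Ξ.μ, ∀ i, 0 ≤ Ξ.P i ω := by
  refine ae_all_iff.2 fun i => ?_
  have h : ∀ᵐ m ∂(Ξ.μ.map (Ξ.m i)), 0 ≤ m := by
    rw [(Ξ.mark_law i).map_eq]; exact net.chan_nonneg
  filter_upwards [ae_of_ae_map (Ξ.measurable_mark i).aemeasurable h] with ω hω
  exact net.power_nonneg _ hω

variable {Ξ} in
theorem maxPower_nonneg {ω : Ξ.Ω} (h : ∀ i, 0 ≤ Ξ.P i ω) : 0 ≤ Ξ.maxPower ω :=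
  Real.iSup_nonneg fun i => h i

variable {Ξ} in
theorem maxPower_le_totalPower {ω : Ξ.Ω} (h : ∀ i, 0 ≤ Ξ.P i ω) :
    Ξ.maxPower ω ≤ Ξ.totalPower ω :=
  Real.iSup_le (fun i => Finset.single_le_sum (f := fun i => Ξ.P i ω) (fun j _ => h j)
    (Finset.mem_range.2 i.2)) (Finset.sum_nonneg fun i _ => h i)

theorem maxPower_le_iff {ω : Ξ.Ω} {p : ℝ} (hp : 0 ≤ p) :
    Ξ.maxPower ω ≤ p ↔ ∀ i ∈ Finset.range (Ξ.N ω), Ξ.P i ω ≤ p := by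
  refine ⟨fun h i hi => ?_, fun h => Real.iSup_le (fun i => h i (Finset.mem_range.2 i.2)) hp⟩
  exact (le_ciSup (f := fun i : Fin (Ξ.N ω) => Ξ.P i ω) (finite_range _).bddAbove
    ⟨i, Finset.mem_range.1 hi⟩).trans h

variable {Ξ} in
-- The quality p/(S - p + W) increases with p, so the strongest node attains the maximum.
theorem sinr_eq {ω : Ξ.Ω} (h : ∀ i, 0 ≤ Ξ.P i ω) :
    Ξ.sinr ω = Ξ.maxPower ω / (Ξ.totalPower ω - Ξ.maxPower ω + net.noise) := by
  have hW := net.noise_pos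
  have hint : ∀ i ∈ Finset.range (Ξ.N ω), Ξ.interference i ω = Ξ.totalPower ω - Ξ.P i ω := by
    intro i hi
    rw [interference, totalPower, ← Finset.sum_erase_add _ _ hi]
    ring
  have hMS := maxPower_le_totalPower h
  rcases Nat.eq_zero_or_pos (Ξ.N ω) with h0 | h0
  · have : IsEmpty (Fin (Ξ.N ω)) := by rw [h0]; infer_instance
    simp [sinr, maxPower, Real.iSup_of_isEmpty]
  · have : Nonempty (Fin (Ξ.N ω)) := ⟨⟨0, h0⟩⟩
    have hle : ∀ i : Fin (Ξ.N ω), Ξ.P i ω ≤ Ξ.maxPower ω := fun i =>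
      le_ciSup (f := fun i : Fin (Ξ.N ω) => Ξ.P i ω) (finite_range _).bddAbove i
    obtain ⟨j, hj⟩ := exists_eq_ciSup_of_finite (f := fun i : Fin (Ξ.N ω) => Ξ.P i ω)
    refine le_antisymm (ciSup_le fun i => ?_) (le_ciSup_of_le (finite_range _).bddAbove j ?_)
    · have := hle i
      rw [Q, hint i (Finset.mem_range.2 i.2)]
      exact div_le_div₀ (maxPower_nonneg h) this (by linarith) (by linarith)
    · rw [Q, hint j (Finset.mem_range.2 j.2), hj]
      rfl

/-- This is the marked generating functional with factors exp(-σq) 1(q ≤ p): their product is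
exp(-σS) when no power exceeds p, and 0 otherwise. -/
theorem lintegral_exp_totalPower {σ p : ℝ} (hσ : 0 < σ) (hp : 0 ≤ p) :
    ∫⁻ ω in Ξ.maxPower ⁻¹' Iic p, ENNReal.ofReal (Real.exp (-(σ * Ξ.totalPower ω))) ∂Ξ.μ =
      ENNReal.ofReal (Real.exp (-(lam * volume.real net.domain *
        (1 - ∫ y in (net.powerLaw.real (Ioi p))..1,
          Real.exp (-(σ * quantile net.powerLaw y)))))) := by
  -- Powers are nonnegative only almost surely; the truncation `max q 0` keeps f in [0,1]
  -- everywhere.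
  let f : ℝ → ℝ := fun q => 1 - (Iic p).indicator (fun q => Real.exp (-(σ * max q 0))) q
  have hfm : Measurable f :=
    measurable_const.sub (Measurable.indicator (by fun_prop) measurableSet_Iic)
  have hexp : ∀ q : ℝ, Real.exp (-(σ * max q 0)) ≤ 1 := fun q => by
    simpa using by positivity
  have hf : ∀ q, f q ∈ Icc (0 : ℝ) 1 := fun q => by
    simp only [f, indicator_apply]
    split_ifs
    · exact ⟨by linarith [hexp q], by linarith [Real.exp_pos (-(σ * max q 0))]⟩
    · simp
  have hfin : IsFiniteMeasure (lam • volume.restrict net.domain) := by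
    have : IsFiniteMeasure (volume.restrict net.domain) := ⟨by
      rw [Measure.restrict_apply_univ]; exact measure_ball_lt_top⟩
    infer_instance
  have key := Ξ.poisson.lintegral_prod_marked (κ := net.chan) Ξ.measurable_mark Ξ.mark_law
    Ξ.mark_indep Ξ.mark_indep_points (ψ := fun p => f (net.power p.1 p.2))
    (hfm.comp net.measurable_power) (fun _ => hf _)
  have hleft : ∫⁻ ω in Ξ.maxPower ⁻¹' Iic p, ENNReal.ofReal (Real.exp (-(σ * Ξ.totalPower ω))) ∂Ξ.μ
      = ∫⁻ ω, ∏ i ∈ Finset.range (Ξ.N ω), ENNReal.ofReal (1 - f (net.power (Ξ.x i ω) (Ξ.m i ω)))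
        ∂Ξ.μ := by
    rw [← lintegral_indicator (Ξ.measurable_maxPower measurableSet_Iic)]
    refine lintegral_congr_ae ?_
    filter_upwards [Ξ.ae_P_nonneg] with ω hω
    change (Ξ.maxPower ⁻¹' Iic p).indicator _ ω =
      ∏ i ∈ Finset.range (Ξ.N ω), ENNReal.ofReal (1 - f (Ξ.P i ω))
    by_cases hM : Ξ.maxPower ω ≤ p
    · rw [indicator_of_mem (by exact hM), totalPower, Finset.mul_sum, ← Finset.sum_neg_distrib,
        Real.exp_sum, ENNReal.ofReal_prod_of_nonneg fun _ _ => (Real.exp_pos _).le]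
      refine Finset.prod_congr rfl fun i hi => ?_
      simp only [f]
      rw [indicator_of_mem (by exact (Ξ.maxPower_le_iff hp).1 hM i hi), max_eq_left (hω i),
        sub_sub_cancel]
    · rw [indicator_of_notMem (by exact hM)]
      rw [Ξ.maxPower_le_iff hp] at hM
      push Not at hM
      obtain ⟨i, hi, hlt⟩ := hM
      refine (Finset.prod_eq_zero hi ?_).symm
      simp only [f]
      rw [indicator_of_notMem (by simpa using hlt)]
      simp
  have hν : (lam • volume.restrict net.domain).prod net.chan =
      ENNReal.ofReal (lam * volume.real net.domain) • net.nodeLaw := by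
    have hd0 : volume net.domain ≠ 0 := (Metric.measure_ball_pos _ _ net.pathloss.Rinf_pos).ne'
    have hd1 : volume net.domain ≠ ⊤ := measure_ball_lt_top.ne
    rw [Network.nodeLaw, ← Measure.prod_smul_left, ProbabilityTheory.cond, smul_smul,
      ENNReal.ofReal_mul (by positivity), ofReal_measureReal hd1, mul_assoc,
      ENNReal.mul_inv_cancel hd0 hd1, mul_one,
      ENNReal.ofReal_coe_nnreal]
    rfl
  rw [hleft, key, hν, integral_smul_measure, net.integral_nodeLaw_power hfm,
    ENNReal.toReal_ofReal (by have := net.measureReal_domain_pos; positivity), smul_eq_mul]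
  congr 5
  have htail : net.powerLaw.real (Ioi p) ≤ 1 := measureReal_le_one
  have h1 : ∫ x in Ioo (0 : ℝ) 1, f (quantile net.powerLaw x) =
      ∫ x in Ioo (0 : ℝ) 1, (1 - (Ioc (net.powerLaw.real (Ioi p)) 1).indicator
        (fun y => Real.exp (-(σ * quantile net.powerLaw y))) x) := by
    refine setIntegral_congr_ae measurableSet_Ioo ?_
    have hne : ∀ᵐ x, x ≠ net.powerLaw.real (Ioi p) := by simp [ae_iff]
    filter_upwards [hne] with x hx hx01
    simp only [f, indicator_apply, max_eq_left (quantile_nonneg x), mem_Iic,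
      quantile_le_iff hx01.1 hp, mem_Ioc, hx01.2.le, and_true]
    congr 2
    exact propext ⟨fun h => lt_of_le_of_ne h hx.symm, fun h => h.le⟩
  have hi := (intervalIntegrable_iff_integrableOn_Ioc_of_le zero_le_one).1
    (intervalIntegrable_exp (measurable_quantile (π := net.powerLaw)) quantile_nonneg hσ.le 0 1)
  rw [h1, integral_sub (by simp) ((hi.mono_set Ioo_subset_Ioc_self).indicator measurableSet_Ioc),
    ← integral_Ioc_eq_integral_Ioo (f := indicator _ _), setIntegral_indicator measurableSet_Ioc,
    inter_eq_right.2 (Ioc_subset_Ioc_left measureReal_nonneg),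
    intervalIntegral.integral_of_le htail]
  simp

theorem lintegral_exp_div_sinr {s : ℝ} (hs : 0 < s) :
    ∫⁻ ω in Ξ.maxPower ⁻¹' Ioi 0, ENNReal.ofReal (Real.exp (-(s * ((Ξ.totalPower ω -
        Ξ.maxPower ω + net.noise) / Ξ.maxPower ω)))) ∂Ξ.μ =
      sinrLaplace (quantile net.powerLaw) net.noise (lam * volume.real net.domain) s :=
  setLIntegral_exp_div_max Ξ.measurable_totalPower Ξ.measurable_maxPower
    (by filter_upwards [Ξ.ae_P_nonneg] with ω hω using Finset.sum_nonneg fun i _ => hω i)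
    (by have := net.measureReal_domain_pos; positivity)
    (fun σ p hσ hp => Ξ.lintegral_exp_totalPower hσ hp) net.noise_pos.le hs

/-- Tonelli for the mixture F(1/T) = ∫ w(s) exp(-sT) ds with T = 1/SINR. Where the maximal power
vanishes, so does the SINR, and F(0) = 0. -/
theorem lintegral_sinr_eq {F : ℝ → ℝ} (hF : F 0 = 0) {w : ℝ → ℝ≥0∞} (hw : Measurable w)
    (hFw : ∀ T : ℝ, 0 < T →
      ∫⁻ s in Ioi 0, w s * ENNReal.ofReal (Real.exp (-(s * T))) = ENNReal.ofReal (F T⁻¹)) :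
    ∫⁻ ω, ENNReal.ofReal (F (Ξ.sinr ω)) ∂Ξ.μ = ∫⁻ s in Ioi 0, w s *
      sinrLaplace (quantile net.powerLaw) net.noise (lam * volume.real net.domain) s := by
  let T : Ξ.Ω → ℝ := fun ω => (Ξ.totalPower ω - Ξ.maxPower ω + net.noise) / Ξ.maxPower ω
  have hT : Measurable T := ((Ξ.measurable_totalPower.sub Ξ.measurable_maxPower).add_const _).div
    Ξ.measurable_maxPower
  have hMm : MeasurableSet (Ξ.maxPower ⁻¹' Ioi 0) := Ξ.measurable_maxPower measurableSet_Ioi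
  calc ∫⁻ ω, ENNReal.ofReal (F (Ξ.sinr ω)) ∂Ξ.μ
      = ∫⁻ ω in Ξ.maxPower ⁻¹' Ioi 0,
          (∫⁻ s in Ioi 0, w s * ENNReal.ofReal (Real.exp (-(s * T ω)))) ∂Ξ.μ := by
        rw [← lintegral_indicator hMm]
        refine lintegral_congr_ae ?_
        filter_upwards [Ξ.ae_P_nonneg] with ω hω
        have hMS := maxPower_le_totalPower hω
        have hW := net.noise_pos
        rcases (maxPower_nonneg hω).eq_or_lt with h0 | h0
        · rw [indicator_of_notMem (by simp [← h0]), sinr_eq hω, ← h0]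
          simp [hF]
        · rw [indicator_of_mem (by exact h0), hFw _ (div_pos (by linarith) h0), sinr_eq hω, inv_div]
    _ = ∫⁻ s in Ioi 0, (∫⁻ ω in Ξ.maxPower ⁻¹' Ioi 0,
          w s * ENNReal.ofReal (Real.exp (-(s * T ω))) ∂Ξ.μ) := by
        refine lintegral_lintegral_swap (Measurable.aemeasurable ?_)
        have : Measurable fun p : Ξ.Ω × ℝ =>
          w p.2 * ENNReal.ofReal (Real.exp (-(p.2 * T p.1))) := by fun_prop
        exact this
    _ = _ := by
        refine setLIntegral_congr_fun measurableSet_Ioi fun s hs => ?_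
        rw [lintegral_const_mul _ (by fun_prop), Ξ.lintegral_exp_div_sinr hs]

theorem meanSinr_eq : Ξ.meanSinr = ∫⁻ s in Ioi 0,
    sinrLaplace (quantile net.powerLaw) net.noise (lam * volume.real net.domain) s := by
  have := Ξ.lintegral_sinr_eq (F := id) rfl (w := fun _ => 1) measurable_const fun T hT => by
    simpa using lintegral_exp_neg_mul hT
  simpa [meanSinr] using this

theorem meanRate_eq : Ξ.meanRate = ∫⁻ s in Ioi 0, logWeight s *
    sinrLaplace (quantile net.powerLaw) net.noise (lam * volume.real net.domain) s :=
  Ξ.lintegral_sinr_eq (F := fun x => Real.log (1 + x)) (by simp) measurable_logWeight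
    fun _ hT => lintegral_logWeight_mul hT

end Realization

/-! ### The mean of the signal quality at high density -/

section Mean

variable {π : Measure ℝ} [IsProbabilityMeasure π]

/-- The density of `sinrLaplace` at `x`, up to the factor `Λ`. -/
noncomputable def sinrDensity (G : ℝ → ℝ) (W Λ s x : ℝ) : ℝ≥0∞ :=
  (G ⁻¹' Ioi 0 ∩ Ioo 0 1).indicator (fun x => ENNReal.ofReal (Real.exp (-(s * W / G x)) *
    Real.exp (-(Λ * (1 - ∫ y in x..1, Real.exp (-(s / G x * G y))))))) x

theorem sinrDensity_of_pos {G : ℝ → ℝ} {W Λ s x : ℝ} (h0 : 0 < G x) (hx : x ∈ Ioo 0 1) :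
    sinrDensity G W Λ s x = ENNReal.ofReal (Real.exp (-(s * W / G x)) *
      Real.exp (-(Λ * (1 - ∫ y in x..1, Real.exp (-(s / G x * G y)))))) :=
  indicator_of_mem (show x ∈ G ⁻¹' Ioi 0 ∩ Ioo 0 1 from ⟨h0, hx⟩) _

theorem measurable_sinrDensity {G : ℝ → ℝ} (hG : Measurable G) (W Λ : ℝ) :
    Measurable fun p : ℝ × ℝ => sinrDensity G W Λ p.1 p.2 := by
  have h1 : Measurable fun p : ℝ × ℝ => ∫ y in p.2..1, Real.exp (-(p.1 / G p.2 * G y)) :=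
    (measurable_integral_exp hG).comp (f := fun p : ℝ × ℝ => (p.1 / G p.2, p.2)) (by fun_prop)
  have h2 : MeasurableSet {p : ℝ × ℝ | p.2 ∈ G ⁻¹' Ioi 0 ∩ Ioo 0 1} :=
    measurable_snd ((hG measurableSet_Ioi).inter measurableSet_Ioo)
  have h3 : Measurable fun p : ℝ × ℝ => ENNReal.ofReal (Real.exp (-(p.1 * W / G p.2)) *
    Real.exp (-(Λ * (1 - ∫ y in p.2..1, Real.exp (-(p.1 / G p.2 * G y)))))) := by fun_prop
  exact h3.indicator h2

theorem sinrLaplace_eq {G : ℝ → ℝ} (hG : Measurable G) (W Λ s : ℝ) :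
    sinrLaplace G W Λ s = ENNReal.ofReal Λ * ∫⁻ x, sinrDensity G W Λ s x := by
  rw [← lintegral_const_mul' _ _ (by simp), sinrLaplace,
    ← lintegral_indicator ((hG measurableSet_Ioi).inter measurableSet_Ioo)]
  refine lintegral_congr fun x => ?_
  by_cases hx : x ∈ G ⁻¹' Ioi 0 ∩ Ioo 0 1
  · rw [indicator_of_mem hx, sinrDensity, indicator_of_mem hx, ← ENNReal.ofReal_mul' (by positivity), mul_assoc]
  · rw [indicator_of_notMem hx, sinrDensity, indicator_of_notMem hx, mul_zero]

theorem measurable_sinrLaplace {G : ℝ → ℝ} (hG : Measurable G) (W Λ : ℝ) :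
    Measurable (sinrLaplace G W Λ) := by
  have : sinrLaplace G W Λ = fun s => ENNReal.ofReal Λ * ∫⁻ x, sinrDensity G W Λ s x :=
    funext (sinrLaplace_eq hG W Λ)
  rw [this]
  exact (measurable_sinrDensity hG W Λ).lintegral_prod_right'.const_mul _

theorem lintegral_sinrLaplace {G : ℝ → ℝ} (hG : Measurable G) (W Λ : ℝ) :
    ∫⁻ s in Ioi 0, sinrLaplace G W Λ s =
      ENNReal.ofReal Λ * ∫⁻ x, ∫⁻ s in Ioi 0, sinrDensity G W Λ s x := by
  simp_rw [sinrLaplace_eq hG W Λ]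
  rw [lintegral_const_mul' _ _ (by simp),
    lintegral_lintegral_swap (measurable_sinrDensity hG W Λ).aemeasurable]

theorem lintegral_exp_neg_mul_div {W g : ℝ} (hW : 0 < W) (hg : 0 < g) :
    ∫⁻ s in Ioi 0, ENNReal.ofReal (Real.exp (-(s * W / g))) = ENNReal.ofReal (g / W) := by
  simp_rw [mul_div_assoc]
  rw [lintegral_exp_neg_mul (div_pos hW hg), inv_div]

/-- Dropping the nonnegative inner integral leaves Λ exp(-Λ) 𝔼(P)/W as a lower bound, the
contribution of the event that there is exactly one node. -/
theorem lintegral_sinrLaplace_eq_top {W Λ : ℝ} (hW : 0 < W) (hΛ : 0 < Λ)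
    (h : ∫⁻ x in Ioo 0 1, ENNReal.ofReal (quantile π x) = ⊤) :
    ∫⁻ s in Ioi 0, sinrLaplace (quantile π) W Λ s = ⊤ := by
  set G := quantile π
  have hG : Measurable G := measurable_quantile
  have hG0 : ∀ x, 0 ≤ G x := quantile_nonneg
  rw [lintegral_sinrLaplace hG W Λ]
  refine ENNReal.mul_eq_top.2 (Or.inl ⟨by simpa using hΛ, top_le_iff.1 ?_⟩)
  calc ⊤ = ENNReal.ofReal (Real.exp (-Λ) / W) * ∫⁻ x in Ioo 0 1, ENNReal.ofReal (G x) := by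
        rw [h, ENNReal.mul_top]
        simpa using by positivity
    _ = ∫⁻ x in Ioo 0 1, ENNReal.ofReal (Real.exp (-Λ) / W) * ENNReal.ofReal (G x) :=
        (lintegral_const_mul' _ _ (by simp)).symm
    _ ≤ ∫⁻ x in Ioo 0 1, ∫⁻ s in Ioi 0, sinrDensity G W Λ s x := by
        refine setLIntegral_mono' measurableSet_Ioo fun x hx => ?_
        rcases (hG0 x).eq_or_lt with h0 | h0
        · simp [← h0]
        calc ENNReal.ofReal (Real.exp (-Λ) / W) * ENNReal.ofReal (G x)
            = ENNReal.ofReal (Real.exp (-Λ)) * ∫⁻ s in Ioi 0,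
                ENNReal.ofReal (Real.exp (-(s * W / G x))) := by
              rw [lintegral_exp_neg_mul_div hW h0, ← ENNReal.ofReal_mul (by positivity),
                ← ENNReal.ofReal_mul (by positivity)]
              congr 1
              ring
          _ = ∫⁻ s in Ioi 0, ENNReal.ofReal (Real.exp (-Λ)) *
                ENNReal.ofReal (Real.exp (-(s * W / G x))) :=
              (lintegral_const_mul' _ _ (by simp)).symm
          _ ≤ _ := by
              refine setLIntegral_mono' measurableSet_Ioi fun s (hs : 0 < s) => ?_
              have hH := (integral_exp_mem_Icc hG hG0 (div_pos hs h0).le hx.2.le).1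
              rw [sinrDensity_of_pos h0 hx, ← ENNReal.ofReal_mul (by positivity),
                mul_comm]
              refine ENNReal.ofReal_le_ofReal ?_
              gcongr
              nlinarith
    _ ≤ _ := setLIntegral_le_lintegral _ _

theorem mul_exp_neg_mul_le {a c : ℝ} (hc : 0 < c) : a * Real.exp (-(a * c)) ≤ c⁻¹ := by
  have h := Real.add_one_le_exp (a * c)
  rw [Real.exp_neg, ← div_eq_mul_inv, div_le_iff₀ (Real.exp_pos _), inv_mul_eq_div,
    le_div_iff₀ hc]
  linarith

/-- Since 1 - exp(-t) ≥ min(t, 1)/2, one of the two terms dominates. Both have explicit integrals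
once multiplied by the noise factor. -/
theorem exp_neg_mul_one_sub_exp_le {c t : ℝ} (hc : 0 ≤ c) (ht : 0 ≤ t) :
    Real.exp (-(2 * c * (1 - Real.exp (-t)))) ≤ Real.exp (-c) + Real.exp (-(c * t)) := by
  rcases le_total t 1 with h | h
  · have h1 : t / 2 ≤ 1 - Real.exp (-t) := by
      have := Real.add_one_le_exp t
      have h2 : Real.exp (-t) ≤ (t + 1)⁻¹ := by
        rw [Real.exp_neg]; gcongr
      have h3 : (t + 1)⁻¹ ≤ 1 - t / 2 := by
        rw [inv_le_iff_one_le_mul₀ (by positivity)]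
        nlinarith
      linarith
    have : Real.exp (-(2 * c * (1 - Real.exp (-t)))) ≤ Real.exp (-(c * t)) := by
      exact Real.exp_le_exp.2 (by nlinarith)
    linarith [Real.exp_pos (-c)]
  · have h1 : (1 : ℝ) / 2 ≤ 1 - Real.exp (-t) := by
      have := Real.add_one_le_exp t
      have h2 : Real.exp (-t) ≤ 2⁻¹ := by
        rw [Real.exp_neg]; gcongr; linarith
      linarith
    have : Real.exp (-(2 * c * (1 - Real.exp (-t)))) ≤ Real.exp (-c) := by
      exact Real.exp_le_exp.2 (by nlinarith)
    linarith [Real.exp_pos (-(c * t))]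

/-- The prefactor Λ must be absorbed. For x ≤ x₀/2, nodes with coordinates in [x₀/2, x₀] interfere
with power at least G(x₀) each and supply decay in s at a rate proportional to Λ. For larger x, half
of exp(-Λx) suffices. -/
theorem exists_lintegral_sinrDensity_le {W : ℝ} (hW : 0 < W) {x₀ : ℝ} (hx₀ : x₀ ∈ Ioo 0 1)
    (hpos : 0 < quantile π x₀) : ∃ C : ℝ, 0 ≤ C ∧ ∀ Λ x : ℝ, 0 < Λ → x ∈ Ioo 0 1 →
      ENNReal.ofReal Λ * ∫⁻ s in Ioi 0, sinrDensity (quantile π) W Λ s x ≤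
        ENNReal.ofReal (C * quantile π x * Real.exp (-(Λ * x / 2))) := by
  set G := quantile π
  have hG : Measurable G := measurable_quantile
  have hG0 : ∀ x, 0 ≤ G x := quantile_nonneg
  -- With this choice 2c is the length of [x₀/2, x₀], and x/2 > c in the second case.
  set c := x₀ / 4
  have hc : 0 < c := div_pos hx₀.1 (by norm_num)
  refine ⟨c⁻¹ * (W⁻¹ + (G x₀)⁻¹), by positivity, fun Λ x hΛ hx => ?_⟩
  rcases (hG0 x).eq_or_lt with h0 | h0
  · simp [sinrDensity, ← h0]
  have hD : ∀ s, 0 < s → sinrDensity G W Λ s x ≤ ENNReal.ofReal (Real.exp (-(Λ * x))) *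
      ENNReal.ofReal (Real.exp (-(s * W / G x))) := fun s hs => by
    have hH := (integral_exp_mem_Icc hG hG0 (div_pos hs h0).le hx.2.le).2
    rw [sinrDensity_of_pos h0 hx, ← ENNReal.ofReal_mul (by positivity), mul_comm]
    refine ENNReal.ofReal_le_ofReal ?_
    gcongr
    linarith
  rcases le_or_gt x (x₀ / 2) with hxx | hxx
  · have hD' : ∀ s, 0 < s → sinrDensity G W Λ s x ≤ ENNReal.ofReal (Real.exp (-(Λ * x))) *
        (ENNReal.ofReal (Real.exp (-(Λ * c))) * ENNReal.ofReal (Real.exp (-(s * W / G x))) +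
          ENNReal.ofReal (Real.exp (-(s * (Λ * c * G x₀) / G x)))) := fun s hs => by
      have hσ := (div_pos hs h0).le
      have hH1 := (integral_exp_mem_Icc hG hG0 hσ (a := x) (b := x₀ / 2) hxx).2
      have hH3 := (integral_exp_mem_Icc hG hG0 hσ hx₀.2.le).2
      have hH2 : ∫ y in (x₀ / 2)..x₀, Real.exp (-(s / G x * G y)) ≤
          (x₀ - x₀ / 2) * Real.exp (-(s / G x * G x₀)) := by
        have := intervalIntegral.integral_mono_on (by linarith [hx₀.1])
          (intervalIntegrable_exp hG hG0 hσ (x₀ / 2) x₀)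
          (intervalIntegrable_const (c := Real.exp (-(s / G x * G x₀)))) fun y hy => by
            have : G x₀ ≤ G y := antitoneOn_quantile (show 0 < y by linarith [hy.1, hx₀.1]) hx₀.1 hy.2
            gcongr
        simpa using this
      have hi := intervalIntegrable_exp hG hG0 hσ
      have hH : ∫ y in x..1, Real.exp (-(s / G x * G y)) ≤
          1 - x - 2 * c * (1 - Real.exp (-(s / G x * G x₀))) := by
        rw [← intervalIntegral.integral_add_adjacent_intervals (hi x (x₀ / 2)) (hi _ 1),
          ← intervalIntegral.integral_add_adjacent_intervals (hi (x₀ / 2) x₀) (hi _ 1)]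
        simp only [c]
        linarith
      have hexp := exp_neg_mul_one_sub_exp_le (c := Λ * c) (t := s / G x * G x₀) (by positivity)
        (by positivity)
      rw [sinrDensity_of_pos h0 hx, ← ENNReal.ofReal_mul (by positivity),
        ← ENNReal.ofReal_add (by positivity) (by positivity), ← ENNReal.ofReal_mul (by positivity)]
      refine ENNReal.ofReal_le_ofReal ?_
      have hE : Real.exp (-(s * W / G x)) ≤ 1 := by simpa using by positivity
      calc Real.exp (-(s * W / G x)) *
            Real.exp (-(Λ * (1 - ∫ y in x..1, Real.exp (-(s / G x * G y)))))
          ≤ Real.exp (-(s * W / G x)) * (Real.exp (-(Λ * x)) *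
            Real.exp (-(2 * (Λ * c) * (1 - Real.exp (-(s / G x * G x₀)))))) := by
            rw [← Real.exp_add (-(Λ * x))]
            gcongr
            nlinarith
        _ ≤ Real.exp (-(s * W / G x)) * (Real.exp (-(Λ * x)) *
            (Real.exp (-(Λ * c)) + Real.exp (-(Λ * c * (s / G x * G x₀))))) := by gcongr
        _ = Real.exp (-(Λ * x)) * (Real.exp (-(Λ * c)) * Real.exp (-(s * W / G x)) +
            Real.exp (-(s * W / G x)) * Real.exp (-(Λ * c * (s / G x * G x₀)))) := by ring
        _ ≤ Real.exp (-(Λ * x)) * (Real.exp (-(Λ * c)) * Real.exp (-(s * W / G x)) +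
            1 * Real.exp (-(Λ * c * (s / G x * G x₀)))) := by gcongr
        _ = _ := by rw [one_mul]; congr 4; ring
    calc ENNReal.ofReal Λ * ∫⁻ s in Ioi 0, sinrDensity G W Λ s x
        ≤ ENNReal.ofReal Λ * ∫⁻ s in Ioi 0, ENNReal.ofReal (Real.exp (-(Λ * x))) *
          (ENNReal.ofReal (Real.exp (-(Λ * c))) * ENNReal.ofReal (Real.exp (-(s * W / G x))) +
            ENNReal.ofReal (Real.exp (-(s * (Λ * c * G x₀) / G x)))) := by
          exact mul_le_mul' le_rfl (setLIntegral_mono' measurableSet_Ioi hD')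
      _ = ENNReal.ofReal (Λ * (Real.exp (-(Λ * x)) * (Real.exp (-(Λ * c)) * (G x / W) +
            G x / (Λ * c * G x₀)))) := by
          rw [lintegral_const_mul' _ _ (by simp), lintegral_add_left (by fun_prop),
            lintegral_const_mul' _ _ (by simp), lintegral_exp_neg_mul_div hW h0,
            lintegral_exp_neg_mul_div (by positivity) h0, ENNReal.ofReal_mul hΛ.le,
            ENNReal.ofReal_mul (by positivity), ENNReal.ofReal_add (by positivity) (by positivity),
            ENNReal.ofReal_mul (Real.exp_pos (-(Λ * c))).le]
      _ ≤ _ := by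
          refine ENNReal.ofReal_le_ofReal ?_
          calc Λ * (Real.exp (-(Λ * x)) * (Real.exp (-(Λ * c)) * (G x / W) + G x / (Λ * c * G x₀)))
              = ((Λ * Real.exp (-(Λ * c))) * W⁻¹ + c⁻¹ * (G x₀)⁻¹) * G x * Real.exp (-(Λ * x)) := by
                field_simp
            _ ≤ (c⁻¹ * W⁻¹ + c⁻¹ * (G x₀)⁻¹) * G x * Real.exp (-(Λ * x / 2)) := by
                have := mul_exp_neg_mul_le (a := Λ) hc
                have : 0 < Λ * x := mul_pos hΛ hx.1
                gcongr
                linarith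
            _ = _ := by ring
  · calc ENNReal.ofReal Λ * ∫⁻ s in Ioi 0, sinrDensity G W Λ s x
        ≤ ENNReal.ofReal Λ * ∫⁻ s in Ioi 0, ENNReal.ofReal (Real.exp (-(Λ * x))) *
          ENNReal.ofReal (Real.exp (-(s * W / G x))) := by
          exact mul_le_mul' le_rfl (setLIntegral_mono' measurableSet_Ioi hD)
      _ = ENNReal.ofReal (Λ * (Real.exp (-(Λ * x)) * (G x / W))) := by
          rw [lintegral_const_mul' _ _ (by simp), lintegral_exp_neg_mul_div hW h0,
            ENNReal.ofReal_mul hΛ.le, ENNReal.ofReal_mul (by positivity)]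
      _ ≤ _ := by
          refine ENNReal.ofReal_le_ofReal ?_
          have h1 := mul_exp_neg_mul_le (a := Λ) (c := x / 2) (by linarith [hx.1])
          have h2 : (x / 2)⁻¹ ≤ c⁻¹ := by gcongr; simp only [c]; linarith
          calc Λ * (Real.exp (-(Λ * x)) * (G x / W))
              = (Λ * Real.exp (-(Λ * (x / 2)))) * W⁻¹ * G x * Real.exp (-(Λ * x / 2)) := by
                rw [show -(Λ * x) = -(Λ * (x / 2)) + -(Λ * x / 2) by ring, Real.exp_add]
                ring
            _ ≤ c⁻¹ * (W⁻¹ + (G x₀)⁻¹) * G x * Real.exp (-(Λ * x / 2)) := by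
                gcongr
                · exact h1.trans h2
                · linarith [inv_pos.2 hpos]

/-- The integrable function C G dominates, and exp(-Λx/2) → 0 for every x > 0. -/
theorem tendsto_lintegral_sinrLaplace {W : ℝ} (hW : 0 < W)
    (hpos : ∃ x₀ ∈ Ioo (0 : ℝ) 1, 0 < quantile π x₀)
    (h : ∫⁻ x in Ioo 0 1, ENNReal.ofReal (quantile π x) < ⊤) :
    Tendsto (fun Λ => ∫⁻ s in Ioi 0, sinrLaplace (quantile π) W Λ s) atTop (𝓝 0) := by
  obtain ⟨x₀, hx₀, hx₀'⟩ := hpos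
  obtain ⟨C, hC, hle⟩ := exists_lintegral_sinrDensity_le hW hx₀ hx₀'
  have hlim : Tendsto (fun Λ => ∫⁻ x in Ioo 0 1,
      ENNReal.ofReal (C * quantile π x * Real.exp (-(Λ * x / 2)))) atTop
      (𝓝 (∫⁻ _ in Ioo (0 : ℝ) 1, 0)) := by
    refine tendsto_lintegral_filter_of_dominated_convergence
      (fun x => ENNReal.ofReal C * ENNReal.ofReal (quantile π x))
      (Eventually.of_forall fun Λ => ?_) ?_ ?_ ?_
    · have := measurable_quantile (π := π)
      fun_prop
    · filter_upwards [eventually_ge_atTop 0] with Λ hΛ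
      filter_upwards [ae_restrict_mem measurableSet_Ioo] with x hx
      rw [← ENNReal.ofReal_mul hC]
      refine ENNReal.ofReal_le_ofReal (mul_le_of_le_one_right ?_ ?_)
      · exact mul_nonneg hC (quantile_nonneg x)
      · have := mul_nonneg hΛ hx.1.le
        simpa using by positivity
    · rw [lintegral_const_mul' _ _ (by simp)]
      exact ENNReal.mul_ne_top (by simp) h.ne
    · filter_upwards [ae_restrict_mem measurableSet_Ioo] with x hx
      rw [← ENNReal.ofReal_zero, ← mul_zero (C * quantile π x)]
      refine ENNReal.tendsto_ofReal (Tendsto.const_mul _ ?_)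
      refine Real.tendsto_exp_neg_atTop_nhds_zero.comp ?_
      simp_rw [mul_div_assoc]
      exact tendsto_id.atTop_mul_const (half_pos hx.1)
  rw [lintegral_zero] at hlim
  refine tendsto_of_tendsto_of_tendsto_of_le_of_le' tendsto_const_nhds hlim
    (Eventually.of_forall fun _ => zero_le) ?_
  filter_upwards [eventually_gt_atTop 0] with Λ hΛ
  rw [lintegral_sinrLaplace measurable_quantile W Λ, ← lintegral_const_mul' _ _ (by simp),
    ← lintegral_indicator measurableSet_Ioo]
  refine lintegral_mono fun x => ?_
  by_cases hx : x ∈ Ioo 0 1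
  · rw [indicator_of_mem hx]
    exact hle Λ x hΛ hx
  · have : ∀ s, sinrDensity (quantile π) W Λ s x = 0 := fun s =>
      indicator_of_notMem (fun h => hx h.2) _
    simp [this]

end Mean

/-! ### Integrability of regularly varying quantile functions -/

section Potter

variable {π : Measure ℝ} [IsProbabilityMeasure π] {α : ℝ≥0∞}

theorem exists_quantile_le (h : RegVaryingNeg (fun t => π.real (Ioi t)) α) {a : ℝ} (ha : 0 < a)
    (haα : ENNReal.ofReal a < α) :
    ∃ C x₀ : ℝ, 0 < C ∧ 0 < x₀ ∧ x₀ < 1 ∧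
      (∀ u v, 0 < u → u ≤ v → v ≤ x₀ → quantile π u ≤ 2 * (v / u) ^ a⁻¹ * quantile π v) ∧
      ∀ u ∈ Ioo (0 : ℝ) 1, quantile π u ≤ C * u ^ (-a⁻¹) := by
  obtain ⟨x₀, h0, h1, hP⟩ := quantile_le_mul_rpow (fun t ht => h.pos ht) ha
    (h.eventually_two_mul_le haα ha.le)
  have hq := quantile_nonneg (π := π) x₀
  -- The summand 1 keeps C positive. Beyond x₀ monotonicity of the quantile replaces the Potter
  -- bound.
  refine ⟨2 * quantile π x₀ + 1, x₀, by positivity, h0, h1, hP, fun u hu => ?_⟩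
  have hu0 := hu.1
  have h2 : u ^ (-a⁻¹) = (1 / u) ^ a⁻¹ := by
    rw [one_div, Real.inv_rpow hu0.le, Real.rpow_neg hu0.le]
  have h3 : 1 ≤ (1 / u) ^ a⁻¹ := Real.one_le_rpow ((one_le_div hu0).2 hu.2.le) (by positivity)
  rw [h2]
  rcases le_total u x₀ with hux | hux
  · calc quantile π u ≤ 2 * (x₀ / u) ^ a⁻¹ * quantile π x₀ := hP u x₀ hu0 hux le_rfl
      _ ≤ 2 * (1 / u) ^ a⁻¹ * quantile π x₀ := by gcongr
      _ ≤ _ := by nlinarith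
  · have := antitoneOn_quantile (π := π) h0 hu0 hux
    nlinarith

/-- The exponent is κ = 1/b with α < b < 1. That κ > 1 makes v^(-κ) integrable at infinity and
forces G to be non-integrable at 0. The factor (1/x₀)^κ in C extends the bound to v > x₀, where G(v)
≤ G(x₀) and v < 1. -/
theorem exists_le_quantile (h : RegVaryingNeg (fun t => π.real (Ioi t)) α) (hα : α < 1) :
    ∃ κ C x₀ : ℝ, 1 < κ ∧ 0 < C ∧ 0 < x₀ ∧ x₀ < 1 ∧ ∀ u v, 0 < u → u ≤ x₀ → u ≤ v → v < 1 →
      quantile π v ≤ C * (u / v) ^ κ * quantile π u := by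
  obtain ⟨b, hb1, hb2⟩ := ENNReal.lt_iff_exists_nnreal_btwn.1 hα
  have hb0 : 0 < (b : ℝ) := by exact_mod_cast (zero_le.trans_lt hb1 : (0 : ℝ≥0∞) < b)
  have hb1' : (b : ℝ) < 1 := by exact_mod_cast hb2
  obtain ⟨x₀, h0, h1, hP⟩ := le_quantile_mul_rpow (fun t ht => h.pos ht) hb0
    (h.eventually_le_two_mul (by simpa using hb1))
  have hκ : 0 < (b : ℝ)⁻¹ := inv_pos.2 hb0
  refine ⟨(b : ℝ)⁻¹, 2 * (1 / x₀) ^ (b : ℝ)⁻¹, x₀, (one_lt_inv₀ hb0).2 hb1', by positivity, h0, h1,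
    fun u v hu hux huv hv => ?_⟩
  have hv0 := hu.trans_le huv
  have hq := quantile_nonneg (π := π) u
  have h3 : 1 ≤ (1 / x₀) ^ (b : ℝ)⁻¹ := Real.one_le_rpow ((one_le_div h0).2 h1.le) hκ.le
  rcases le_total v x₀ with hvx | hvx
  · calc quantile π v ≤ 2 * 1 * (u / v) ^ (b : ℝ)⁻¹ * quantile π u := by
          simpa using hP u v hu huv hvx
      _ ≤ _ := by gcongr
  · calc quantile π v ≤ quantile π x₀ := antitoneOn_quantile h0 hv0 hvx
      _ ≤ 2 * (u / x₀) ^ (b : ℝ)⁻¹ * quantile π u := hP u x₀ hu hux le_rfl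
      _ ≤ 2 * (1 / x₀ * (u / v)) ^ (b : ℝ)⁻¹ * quantile π u := by
          gcongr
          rw [div_mul_div_comm, one_mul]
          gcongr
          nlinarith
      _ = _ := by rw [Real.mul_rpow (by positivity) (by positivity)]; ring

theorem lintegral_quantile_lt_top (h : RegVaryingNeg (fun t => π.real (Ioi t)) α) (hα : 1 < α) :
    ∫⁻ x in Ioo 0 1, ENNReal.ofReal (quantile π x) < ⊤ := by
  obtain ⟨b, hb1, hb2⟩ := ENNReal.lt_iff_exists_nnreal_btwn.1 hα
  have hb1' : 1 < (b : ℝ) := by exact_mod_cast hb1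
  have hb0 : 0 < (b : ℝ) := by linarith
  obtain ⟨C, x₀, hC, -, -, -, hle⟩ := exists_quantile_le h hb0 (by simpa using hb2)
  have hi : IntegrableOn (fun u : ℝ => C * u ^ (-(b : ℝ)⁻¹)) (Ioo 0 1) := by
    refine IntegrableOn.mono_set ?_ Ioo_subset_Ioc_self
    refine (intervalIntegrable_iff_integrableOn_Ioc_of_le zero_le_one).1
      ((intervalIntegral.intervalIntegrable_rpow' ?_).const_mul C)
    have := inv_lt_one_of_one_lt₀ hb1'
    linarith
  refine (setLIntegral_mono' measurableSet_Ioo fun u hu => ENNReal.ofReal_le_ofReal (hle u hu)).trans_lt ?_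
  refine lt_top_iff_ne_top.2 ((lintegral_ofReal_ne_top_iff_integrable hi.aestronglyMeasurable ?_).2 hi)
  filter_upwards [ae_restrict_mem measurableSet_Ioo] with u hu
  have := hu.1
  simp only [Pi.zero_apply]
  positivity

theorem lintegral_quantile_eq_top (h : RegVaryingNeg (fun t => π.real (Ioi t)) α) (hα : α < 1) :
    ∫⁻ x in Ioo 0 1, ENNReal.ofReal (quantile π x) = ⊤ := by
  obtain ⟨κ, C, x₀, hκ, hC, h0, h1, hle⟩ := exists_le_quantile h hα
  obtain ⟨v, hv, hv0⟩ := ((tendsto_quantile_zero (π := π) fun t ht => h.pos ht).eventually_gt_atTop 0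
    |>.and (Ioo_mem_nhdsGT h0)).exists
  by_contra hcon
  have hi : IntegrableOn (quantile π) (Ioo 0 v) :=
    IntegrableOn.mono_set ((lintegral_ofReal_ne_top_iff_integrable
      measurable_quantile.aestronglyMeasurable (Eventually.of_forall quantile_nonneg)).1 hcon)
      (Ioo_subset_Ioo_right (hv0.2.trans h1).le)
  have hi2 : IntegrableOn (fun u : ℝ => u⁻¹) (Ioo 0 v) := by
    -- With v fixed and κ > 1, the lower bound on G(u) is at least a multiple of 1/u.
    refine (hi.const_mul (C / (v * quantile π v))).mono' (by fun_prop) ?_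
    filter_upwards [ae_restrict_mem measurableSet_Ioo] with u hu
    have hu0 := hu.1
    rw [Real.norm_of_nonneg (by positivity)]
    have h2 := hle u v hu0 (hu.2.trans hv0.2).le hu.2.le (hv0.2.trans h1)
    have h3 : (u / v) ^ κ ≤ u / v := by
      simpa using Real.rpow_le_rpow_of_exponent_ge (div_pos hu0 hv0.1)
        ((div_le_one hv0.1).2 hu.2.le) hκ.le
    have h4 : quantile π v ≤ C * (u / v) * quantile π u :=
      h2.trans (by have := quantile_nonneg (π := π) u; gcongr)
    have hvp := hv0.1
    rw [div_mul_eq_mul_div, le_div_iff₀ (by positivity), inv_mul_le_iff₀ hu0]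
    calc v * quantile π v ≤ v * (C * (u / v) * quantile π u) := by gcongr
      _ = _ := by field_simp
  have hi3 : IntervalIntegrable (fun u : ℝ => u⁻¹) volume 0 v :=
    (intervalIntegrable_iff_integrableOn_Ioo_of_le hv0.1.le).2 hi2
  rcases intervalIntegrable_inv_iff.1 hi3 with h5 | h5
  · exact hv0.1.ne h5
  · exact h5 left_mem_uIcc

end Potter

/-! ### The limiting rate -/

/-- The limit of `sinrLaplace` at high density. -/
noncomputable def limitLaplace (α : ℝ≥0∞) (s : ℝ) : ℝ≥0∞ :=
  ∫⁻ u in Ioi 0, ENNReal.ofReal (Real.exp (-u)) * EReal.exp (-(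
    (∫⁻ v in Ioi u, ENNReal.ofReal (1 - Real.exp (-(s * ratioLimit α (v / u)))) : ℝ≥0∞) : EReal))

/-- The limit of the average rate at high density. -/
noncomputable def limitRate (α : ℝ≥0∞) : ℝ≥0∞ := ∫⁻ s in Ioi 0, logWeight s * limitLaplace α s

/-- For v > u the ratio (v/u)^(-1/α) grows with α, hence so does the inner exponent. -/
theorem limitRate_anti {α₁ α₂ : ℝ≥0∞} (h : α₁ ≤ α₂) : limitRate α₂ ≤ limitRate α₁ := by
  refine setLIntegral_mono' measurableSet_Ioi fun s (hs : 0 < s) => mul_le_mul' le_rfl ?_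
  refine setLIntegral_mono' measurableSet_Ioi fun u (hu : 0 < u) => mul_le_mul' le_rfl ?_
  refine EReal.exp_le_exp_iff.2 (EReal.neg_le_neg_iff.2 (EReal.coe_ennreal_le_coe_ennreal_iff.2 ?_))
  refine setLIntegral_mono' measurableSet_Ioi fun v (hv : u < v) => ENNReal.ofReal_le_ofReal ?_
  have := ratioLimit_mono h ((one_le_div hu).2 hv.le)
  gcongr

theorem lintegral_exp_neg_Ioi_zero : ∫⁻ u in Ioi (0 : ℝ), ENNReal.ofReal (Real.exp (-u)) = 1 := by
  simpa using lintegral_exp_neg_mul one_pos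

/-- Taking T = 1/n in `lintegral_logWeight_mul` and bounding the exponential by 1 gives at least
log(1 + n) for every n. -/
theorem lintegral_logWeight : ∫⁻ s in Ioi 0, logWeight s = ⊤ := by
  have h : ∀ n : ℕ, ENNReal.ofReal (Real.log (1 + n)) ≤ ∫⁻ s in Ioi 0, logWeight s := by
    intro n
    rcases Nat.eq_zero_or_pos n with rfl | hn
    · simp
    have hn' : (0 : ℝ) < n := by exact_mod_cast hn
    rw [← inv_inv (n : ℝ), ← lintegral_logWeight_mul (inv_pos.2 hn')]
    refine setLIntegral_mono' measurableSet_Ioi fun s (hs : 0 < s) => mul_le_of_le_one_right' ?_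
    simpa using by positivity
  have ht : Tendsto (fun n : ℕ => ENNReal.ofReal (Real.log (1 + n))) atTop (𝓝 ⊤) :=
    ENNReal.tendsto_ofReal_atTop.comp (Real.tendsto_log_atTop.comp
      (tendsto_atTop_add_const_left _ _ tendsto_natCast_atTop_atTop))
  exact top_le_iff.1 (le_of_tendsto' ht h)

/-- For α = 0 the strongest node dwarfs all others: the ratio limit is 0 and no interference
survives. -/
theorem limitRate_zero : limitRate 0 = ⊤ := by
  have : ∀ s, limitLaplace 0 s = 1 := fun s => by
    simp [limitLaplace, ratioLimit, lintegral_exp_neg_Ioi_zero]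
  simp [limitRate, this, lintegral_logWeight]

/-- When the limit has infinite integral, Fatou's lemma replaces domination. -/
theorem tendsto_lintegral_top {X ι : Type*} [MeasurableSpace X] {μ : Measure X} {l : Filter ι}
    [l.IsCountablyGenerated] {f : ι → X → ℝ≥0∞} {g : X → ℝ≥0∞} (hf : ∀ i, Measurable (f i))
    (hlim : ∀ᵐ x ∂μ, Tendsto (fun i => f i x) l (𝓝 (g x))) (hg : ∫⁻ x, g x ∂μ = ⊤) :
    Tendsto (fun i => ∫⁻ x, f i x ∂μ) l (𝓝 ⊤) := by
  rcases l.eq_or_neBot with rfl | hl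
  · simp
  have h1 : ∫⁻ x, g x ∂μ = ∫⁻ x, liminf (fun i => f i x) l ∂μ :=
    lintegral_congr_ae (by filter_upwards [hlim] with x hx using hx.liminf_eq.symm)
  have h2 := lintegral_liminf_le (μ := μ) (u := l) hf
  rw [← h1, hg, top_le_iff] at h2
  exact tendsto_of_le_liminf_of_limsup_le h2.ge le_top

/-- For α ≥ 1 the ratio is at least u/v, and 1 - exp(-t) ≥ t/(1 + t) bounds the integrand below by a
multiple of 1/v, whose integral diverges. The factor exp(-∞) = 0 then makes `limitLaplace` vanish.
-/
theorem lintegral_one_sub_exp_ratioLimit {α : ℝ≥0∞} (hα : 1 ≤ α) {s u : ℝ} (hs : 0 < s)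
    (hu : 0 < u) :
    ∫⁻ v in Ioi u, ENNReal.ofReal (1 - Real.exp (-(s * ratioLimit α (v / u)))) = ⊤ := by
  have hle : ∀ v ∈ Ioi u, ENNReal.ofReal (s * u / (1 + s)) * ENNReal.ofReal v⁻¹ ≤
      ENNReal.ofReal (1 - Real.exp (-(s * ratioLimit α (v / u)))) := by
    intro v (hv : u < v)
    have hv0 := hu.trans hv
    have h1 : u / v ≤ ratioLimit α (v / u) := by
      refine le_trans (le_of_eq ?_) (ratioLimit_mono hα ((one_le_div hu).2 hv.le))
      simp [ratioLimit, Real.rpow_neg_one]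
    have h2 : Real.exp (-(s * ratioLimit α (v / u))) ≤ (1 + s * (u / v))⁻¹ := by
      rw [Real.exp_neg]
      have := Real.add_one_le_exp (s * ratioLimit α (v / u))
      gcongr
      nlinarith
    rw [← ENNReal.ofReal_mul (by positivity)]
    refine ENNReal.ofReal_le_ofReal ?_
    have h3 : (1 + s * (u / v))⁻¹ = 1 - s * u / (v + s * u) := by
      field_simp
      ring
    have h4 : s * u / (1 + s) * v⁻¹ ≤ s * u / (v + s * u) := by
      rw [← div_eq_mul_inv, div_div]
      gcongr
      nlinarith
    linarith
  refine top_le_iff.1 (le_trans (le_of_eq ?_) (setLIntegral_mono' measurableSet_Ioi hle))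
  rw [lintegral_const_mul' _ _ (by simp), ENNReal.mul_eq_top.2]
  refine Or.inl ⟨by simpa using by positivity, ?_⟩
  by_contra hcon
  refine not_integrableOn_Ioi_inv ((lintegral_ofReal_ne_top_iff_integrable (by fun_prop) ?_).1 hcon)
  filter_upwards [ae_restrict_mem measurableSet_Ioi] with v hv
  have := hu.trans hv
  simp only [Pi.zero_apply]
  positivity

/-! ### Convergence of the rate at high density -/

theorem lintegral_eq_lintegral_div {Λ : ℝ} (hΛ : 0 < Λ) (f : ℝ → ℝ≥0∞) :
    ENNReal.ofReal Λ * ∫⁻ x, f x = ∫⁻ u, f (u / Λ) := by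
  have h := Real.smul_map_volume_mul_left (inv_ne_zero hΛ.ne')
  have h2 : ∫⁻ x, f x = ENNReal.ofReal Λ⁻¹ * ∫⁻ u, f (Λ⁻¹ * u) := by
    conv_lhs => rw [← h]
    rw [lintegral_smul_measure, abs_of_pos (inv_pos.2 hΛ), smul_eq_mul]
    congr 1
    exact lintegral_map_equiv f (MeasurableEquiv.mulLeft₀ Λ⁻¹ (inv_ne_zero hΛ.ne'))
  rw [h2, ← mul_assoc, ← ENNReal.ofReal_mul hΛ.le, mul_inv_cancel₀ hΛ.ne', ENNReal.ofReal_one,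
    one_mul]
  simp_rw [inv_mul_eq_div]

theorem sinrDensity_div_cases {G : ℝ → ℝ} {W Λ s u : ℝ} (hΛ : 0 < Λ) {B : ℝ≥0∞}
    (h : u < Λ → 0 < G (u / Λ) → sinrDensity G W Λ s (u / Λ) ≤ B) :
    sinrDensity G W Λ s (u / Λ) ≤ B := by
  by_cases hu : u / Λ ∈ G ⁻¹' Ioi 0 ∩ Ioo 0 1
  · exact h ((div_lt_one hΛ).1 hu.2.2) hu.1
  · rw [sinrDensity, indicator_of_notMem hu]
    exact zero_le

section Rate

variable {π : Measure ℝ} [IsProbabilityMeasure π] {α : ℝ≥0∞} {W : ℝ}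

theorem sinrDensity_div_eq {G : ℝ → ℝ} {W Λ s u : ℝ} (hu : 0 < u) (huΛ : u < Λ)
    (h0 : 0 < G (u / Λ)) :
    sinrDensity G W Λ s (u / Λ) = ENNReal.ofReal (Real.exp (-(s * W / G (u / Λ))) *
      Real.exp (-(Λ - ∫ v in u..Λ, Real.exp (-(s * (G (v / Λ) / G (u / Λ))))))) := by
  have hΛ := hu.trans huΛ
  rw [sinrDensity_of_pos h0 ⟨div_pos hu hΛ, (div_lt_one hΛ).2 huΛ⟩]
  congr 4
  rw [mul_sub, mul_one]
  congr 1
  have h1 := intervalIntegral.integral_comp_div (a := u) (b := Λ)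
    (fun y => Real.exp (-(s / G (u / Λ) * G y))) hΛ.ne'
  rw [div_self hΛ.ne', smul_eq_mul] at h1
  rw [← h1]
  congr 1 with v
  ring_nf

theorem sinrDensity_div_of_notMem {G : ℝ → ℝ} {W Λ s u : ℝ} (hΛ : 0 < Λ) (hu : u ∉ Ioi (0 : ℝ)) :
    sinrDensity G W Λ s (u / Λ) = 0 := by
  refine indicator_of_notMem (fun h => hu ?_) _
  exact (div_pos_iff_of_pos_right hΛ).1 h.2.1

theorem sinrLaplace_eq_div {G : ℝ → ℝ} (hG : Measurable G) (W s : ℝ) {Λ : ℝ} (hΛ : 0 < Λ) :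
    sinrLaplace G W Λ s = ∫⁻ u in Ioi 0, sinrDensity G W Λ s (u / Λ) := by
  rw [sinrLaplace_eq hG, lintegral_eq_lintegral_div hΛ, ← lintegral_indicator measurableSet_Ioi]
  refine lintegral_congr fun u => ?_
  by_cases hu : u ∈ Ioi 0
  · rw [indicator_of_mem hu]
  · rw [indicator_of_notMem hu, sinrDensity_div_of_notMem hΛ hu]

theorem intervalIntegrable_exp_ratio {s Λ g : ℝ} (hs : 0 ≤ s) (hg : 0 ≤ g) (a b : ℝ) :
    IntervalIntegrable (fun v => Real.exp (-(s * (quantile π (v / Λ) / g)))) volume a b :=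
  intervalIntegrable_exp (G := fun v => quantile π (v / Λ) / g)
    ((measurable_quantile.comp (by fun_prop)).div_const g)
    (fun _ => div_nonneg (quantile_nonneg _) hg) hs a b

theorem integral_exp_ratio_le {s Λ g : ℝ} (hs : 0 ≤ s) (hg : 0 ≤ g) {a b : ℝ} (hab : a ≤ b) :
    ∫ v in a..b, Real.exp (-(s * (quantile π (v / Λ) / g))) ≤ b - a :=
  (integral_exp_mem_Icc (G := fun v => quantile π (v / Λ) / g)
    ((measurable_quantile.comp (by fun_prop)).div_const g)
    (fun _ => div_nonneg (quantile_nonneg _) hg) hs hab).2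

theorem sinrDensity_div_le_exp (hW : 0 ≤ W) {Λ s u : ℝ} (hΛ : 0 < Λ) (hs : 0 ≤ s) (hu : 0 < u) :
    sinrDensity (quantile π) W Λ s (u / Λ) ≤ ENNReal.ofReal (Real.exp (-u)) := by
  refine sinrDensity_div_cases hΛ fun huΛ h0 => ?_
  rw [sinrDensity_div_eq hu huΛ h0]
  refine ENNReal.ofReal_le_ofReal ?_
  have h1 := integral_exp_ratio_le (π := π) (Λ := Λ) hs h0.le huΛ.le
  have h2 : Real.exp (-(s * W / quantile π (u / Λ))) ≤ 1 := by simpa using by positivity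
  calc _ ≤ 1 * Real.exp (-u) := by
        gcongr
        linarith
    _ = _ := one_mul _

/-- The inner exponent of the scaled kernel converges to that of `limitLaplace`. -/
theorem tendsto_lintegral_one_sub_exp (h : RegVaryingNeg (fun t => π.real (Ioi t)) α) {s u : ℝ}
    (hs : 0 < s) (hu : 0 < u) :
    Tendsto (fun Λ => ∫⁻ v in Ioi u, (Iio Λ).indicator (fun v =>
        ENNReal.ofReal (1 - Real.exp (-(s * (quantile π (v / Λ) / quantile π (u / Λ)))))) v) atTop
      (𝓝 (∫⁻ v in Ioi u, ENNReal.ofReal (1 - Real.exp (-(s * ratioLimit α (v / u)))))) := by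
  have hG : Measurable (quantile π) := measurable_quantile
  have hux : Tendsto (fun Λ => u / Λ) atTop (𝓝[>] 0) := by
    refine tendsto_nhdsWithin_iff.2 ⟨tendsto_const_nhds.div_atTop tendsto_id, ?_⟩
    filter_upwards [eventually_gt_atTop 0] with Λ hΛ using div_pos hu hΛ
  have hlim : ∀ᵐ v ∂volume.restrict (Ioi u), Tendsto (fun Λ => (Iio Λ).indicator (fun v =>
        ENNReal.ofReal (1 - Real.exp (-(s * (quantile π (v / Λ) / quantile π (u / Λ)))))) v) atTop
      (𝓝 (ENNReal.ofReal (1 - Real.exp (-(s * ratioLimit α (v / u)))))) := by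
    filter_upwards [ae_restrict_mem measurableSet_Ioi] with v (hv : u < v)
    have h1 : Tendsto (fun Λ => quantile π (v / Λ) / quantile π (u / Λ)) atTop
        (𝓝 (ratioLimit α (v / u))) := by
      refine ((tendsto_quantile_ratio h ((one_lt_div hu).2 hv)).comp hux).congr fun Λ => ?_
      simp only [Function.comp]
      congr 2
      field_simp
    have h2 : Tendsto (fun Λ => ENNReal.ofReal (1 - Real.exp (-(s * (quantile π (v / Λ) /
        quantile π (u / Λ)))))) atTop
        (𝓝 (ENNReal.ofReal (1 - Real.exp (-(s * ratioLimit α (v / u)))))) :=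
      ENNReal.tendsto_ofReal (((Real.continuous_exp.tendsto _).comp (h1.const_mul s).neg).const_sub 1)
    refine h2.congr' ?_
    filter_upwards [eventually_gt_atTop v] with Λ hΛ
    rw [indicator_of_mem (by exact hΛ)]
  have hmeas : ∀ Λ : ℝ, Measurable ((Iio Λ).indicator (fun v =>
        ENNReal.ofReal (1 - Real.exp (-(s * (quantile π (v / Λ) / quantile π (u / Λ))))))) := fun Λ =>
    Measurable.indicator (by fun_prop) measurableSet_Iio
  rcases le_or_gt 1 α with hα | hα
  · have htop := lintegral_one_sub_exp_ratioLimit hα hs hu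
    rw [htop]
    exact tendsto_lintegral_top hmeas hlim htop
  -- For α < 1, 1 - exp(-t) ≤ t and the Potter bound give a majorant proportional to v^(-κ) with κ >
  -- 1.
  obtain ⟨κ, C, x₀, hκ, hC, hx₀, hx₁, hle⟩ := exists_le_quantile h hα
  refine tendsto_lintegral_filter_of_dominated_convergence
    (fun v => ENNReal.ofReal (s * C * u ^ κ * v ^ (-κ))) (Eventually.of_forall hmeas) ?_ ?_ hlim
  · filter_upwards [hux.eventually (Ioo_mem_nhdsGT hx₀), (hux.eventually
      ((tendsto_quantile_zero (π := π) fun t ht => h.pos ht).eventually_gt_atTop 0)),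
      eventually_gt_atTop 0] with Λ h1 h2 hΛ
    filter_upwards [ae_restrict_mem measurableSet_Ioi] with v (hv : u < v)
    have hv0 := hu.trans hv
    by_cases hvΛ : v ∈ Iio Λ
    swap
    · rw [indicator_of_notMem hvΛ]
      exact zero_le
    rw [indicator_of_mem hvΛ]
    refine ENNReal.ofReal_le_ofReal ?_
    have h3 := hle (u / Λ) (v / Λ) h1.1 h1.2.le (by gcongr) ((div_lt_one hΛ).2 hvΛ)
    rw [div_div_div_cancel_right₀ hΛ.ne', ← div_le_iff₀ h2, Real.div_rpow hu.le hv0.le] at h3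
    have h4 := Real.add_one_le_exp (-(s * (quantile π (v / Λ) / quantile π (u / Λ))))
    rw [Real.rpow_neg hv0.le]
    calc 1 - Real.exp (-(s * (quantile π (v / Λ) / quantile π (u / Λ))))
        ≤ s * (quantile π (v / Λ) / quantile π (u / Λ)) := by linarith
      _ ≤ s * (C * (u ^ κ / v ^ κ)) := by gcongr
      _ = _ := by ring
  · have hi : IntegrableOn (fun v : ℝ => s * C * u ^ κ * v ^ (-κ)) (Ioi u) :=
      (integrableOn_Ioi_rpow_of_lt (by linarith) hu).const_mul _
    refine (lintegral_ofReal_ne_top_iff_integrable hi.aestronglyMeasurable ?_).2 hi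
    filter_upwards [ae_restrict_mem measurableSet_Ioi] with v hv
    have := hu.trans hv
    simp only [Pi.zero_apply]
    positivity

/-- The noise factor tends to 1 because G(u/Λ) → ∞. Continuity of the exponential on the extended
reals covers finite and infinite limiting exponents together. -/
theorem tendsto_sinrDensity_div (h : RegVaryingNeg (fun t => π.real (Ioi t)) α) (W : ℝ) {s u : ℝ}
    (hs : 0 < s) (hu : 0 < u) :
    Tendsto (fun Λ => sinrDensity (quantile π) W Λ s (u / Λ)) atTop
      (𝓝 (ENNReal.ofReal (Real.exp (-u)) * EReal.exp (-((∫⁻ v in Ioi u,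
        ENNReal.ofReal (1 - Real.exp (-(s * ratioLimit α (v / u)))) : ℝ≥0∞) : EReal)))) := by
  have hG : Measurable (quantile π) := measurable_quantile
  have hux : Tendsto (fun Λ => u / Λ) atTop (𝓝[>] 0) := by
    refine tendsto_nhdsWithin_iff.2 ⟨tendsto_const_nhds.div_atTop tendsto_id, ?_⟩
    filter_upwards [eventually_gt_atTop 0] with Λ hΛ using div_pos hu hΛ
  have hGu : Tendsto (fun Λ => quantile π (u / Λ)) atTop atTop :=
    (tendsto_quantile_zero (π := π) fun t ht => h.pos ht).comp hux
  have h1 : Tendsto (fun Λ => ENNReal.ofReal (Real.exp (-(s * W / quantile π (u / Λ))))) atTop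
      (𝓝 1) := by
    rw [← ENNReal.ofReal_one, ← Real.exp_zero, ← neg_zero]
    exact ENNReal.tendsto_ofReal ((Real.continuous_exp.tendsto _).comp
      (tendsto_const_nhds.div_atTop hGu).neg)
  have h2 := (ENNReal.continuous_exp.tendsto _).comp
    ((continuous_coe_ennreal_ereal.neg.tendsto _).comp (tendsto_lintegral_one_sub_exp h hs hu))
  have h3 := ENNReal.Tendsto.mul h1 (Or.inl one_ne_zero)
    (ENNReal.Tendsto.const_mul h2 (Or.inr (ENNReal.ofReal_ne_top (r := Real.exp (-u)))))
    (Or.inr ENNReal.one_ne_top)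
  rw [one_mul] at h3
  refine h3.congr' ?_
  filter_upwards [hGu.eventually_gt_atTop 0, eventually_gt_atTop u] with Λ h0 huΛ
  have hi := intervalIntegrable_exp_ratio (π := π) (Λ := Λ) hs.le h0.le u Λ
  have hi' : IntervalIntegrable (fun v => 1 - Real.exp (-(s * (quantile π (v / Λ) /
      quantile π (u / Λ))))) volume u Λ := intervalIntegrable_const.sub hi
  have hI : ∫⁻ v in Ioi u, (Iio Λ).indicator (fun v => ENNReal.ofReal
      (1 - Real.exp (-(s * (quantile π (v / Λ) / quantile π (u / Λ)))))) v =
      ENNReal.ofReal (Λ - u - ∫ v in u..Λ,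
        Real.exp (-(s * (quantile π (v / Λ) / quantile π (u / Λ))))) := by
    rw [lintegral_indicator measurableSet_Iio, Measure.restrict_restrict measurableSet_Iio,
      Iio_inter_Ioi, ← ofReal_integral_eq_lintegral_ofReal
        ((intervalIntegrable_iff_integrableOn_Ioo_of_le huΛ.le).1 hi')
        (Eventually.of_forall fun v => ?_), ← integral_Ioc_eq_integral_Ioo,
      ← intervalIntegral.integral_of_le huΛ.le,
      intervalIntegral.integral_sub intervalIntegrable_const hi]
    · simp
    · have := exp_neg_mul_le_one hs.le (div_nonneg (quantile_nonneg (π := π) (v / Λ)) h0.le)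
      simpa using this
  have hle := integral_exp_ratio_le (π := π) (Λ := Λ) hs.le h0.le huΛ.le
  simp only [Function.comp, Pi.neg_apply]
  rw [hI, EReal.coe_ennreal_ofReal, max_eq_left (by linarith), ← EReal.coe_neg, EReal.exp_coe,
    ← ENNReal.ofReal_mul (Real.exp_pos _).le, ← Real.exp_add,
    ← ENNReal.ofReal_mul (Real.exp_pos _).le, sinrDensity_div_eq hu huΛ h0]
  congr 3
  ring

theorem tendsto_sinrLaplace (h : RegVaryingNeg (fun t => π.real (Ioi t)) α) (hW : 0 ≤ W) {s : ℝ}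
    (hs : 0 < s) :
    Tendsto (fun Λ => sinrLaplace (quantile π) W Λ s) atTop (𝓝 (limitLaplace α s)) := by
  have hG : Measurable (quantile π) := measurable_quantile
  have hlim : Tendsto (fun Λ => ∫⁻ u in Ioi 0, sinrDensity (quantile π) W Λ s (u / Λ)) atTop
      (𝓝 (limitLaplace α s)) := by
    refine tendsto_lintegral_filter_of_dominated_convergence
      (fun u => ENNReal.ofReal (Real.exp (-u))) (Eventually.of_forall fun Λ => ?_) ?_ ?_ ?_
    · exact (measurable_sinrDensity hG W Λ).comp (f := fun u : ℝ => (s, u / Λ)) (by fun_prop)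
    · filter_upwards [eventually_gt_atTop 0] with Λ hΛ
      filter_upwards [ae_restrict_mem measurableSet_Ioi] with u hu
      exact sinrDensity_div_le_exp hW hΛ hs.le hu
    · simp [lintegral_exp_neg_Ioi_zero]
    · filter_upwards [ae_restrict_mem measurableSet_Ioi] with u hu
      exact tendsto_sinrDensity_div h W hs hu
  refine hlim.congr' ?_
  filter_upwards [eventually_gt_atTop 0] with Λ hΛ
  exact (sinrLaplace_eq_div hG W s hΛ).symm

theorem exp_neg_le_rpow_neg {y δ : ℝ} (hy : 0 < y) (hδ0 : 0 ≤ δ) (hδ1 : δ ≤ 1) :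
    Real.exp (-y) ≤ y ^ (-δ) := by
  rw [Real.exp_neg, Real.rpow_neg hy.le]
  have h1 : y ^ δ ≤ Real.exp y := by
    have := Real.add_one_le_exp y
    rcases le_total y 1 with h | h
    · have := Real.rpow_le_one hy.le h hδ0
      linarith
    · have := Real.rpow_le_rpow_of_exponent_le h hδ1
      rw [Real.rpow_one] at this
      linarith
  gcongr

/-- With q the noise factor and k(v) the factor of an interferer at v, the density is q exp(-Λ)
exp(∫ k) over (u, Λ). Expanding the last exponential by the fundamental theorem of calculus (in
effect, according to the second strongest node) bounds it by q exp(-Λ) + ∫ q k(v) exp(-v) dv. Each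
of q k(v) and q at v = Λ is at most B exp(v/2), with B of order s^(-δ). -/
theorem exists_sinrDensity_div_le (h : RegVaryingNeg (fun t => π.real (Ioi t)) α) (hα : 0 < α)
    (hW : 0 < W) : ∃ δ c : ℝ, 0 < δ ∧ 0 < c ∧ ∀ Λ s u : ℝ, 0 < Λ → 0 < s → 0 < u →
      sinrDensity (quantile π) W Λ s (u / Λ) ≤
        ENNReal.ofReal (2 * (s * c) ^ (-δ) * (u ^ (-(1 / 2) : ℝ) * Real.exp (-(1 / 2) * u))) := by
  -- b < α serves the Potter bound; b < 1 keeps δ = b/2 below 1, as `exp_neg_le_rpow_neg` requires.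
  obtain ⟨b, hb1, hb2⟩ := ENNReal.lt_iff_exists_nnreal_btwn.1 (lt_min hα one_pos)
  have hb0 : 0 < (b : ℝ) := by exact_mod_cast hb1
  have hb1' : (b : ℝ) < 1 := by exact_mod_cast hb2.trans_le (min_le_right _ _)
  obtain ⟨C, x₀, hC, hx₀, hx₁, hP, hP2⟩ := exists_quantile_le h hb0
    (by simpa using hb2.trans_le (min_le_left _ _))
  set κ := (b : ℝ)⁻¹
  have hκ : 0 < κ := inv_pos.2 hb0
  -- The first constant comes from interference at v ≤ x₀Λ, by the Potter bound; the second from the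
  -- noise at v ≥ x₀Λ.
  set c := min (1 / 2) (W * x₀ ^ κ / C)
  have hc : 0 < c := lt_min (by norm_num) (by positivity)
  refine ⟨b / 2, c, by positivity, hc, fun Λ s u hΛ hs hu => sinrDensity_div_cases hΛ fun huΛ h0 => ?_⟩
  set g := quantile π (u / Λ)
  set q := Real.exp (-(s * W / g))
  set k : ℝ → ℝ := fun v => Real.exp (-(s * (quantile π (v / Λ) / g)))
  set B := (s * c) ^ (-(b / 2 : ℝ)) * u ^ (-(1 / 2) : ℝ)
  have hq : q ≤ 1 := by simpa [q] using by positivity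
  have hk1 : ∀ v, k v ≤ 1 := fun v =>
    exp_neg_mul_le_one hs.le (div_nonneg (quantile_nonneg _) h0.le)
  have hki : ∀ a b, IntervalIntegrable k volume a b := intervalIntegrable_exp_ratio hs.le h0.le
  have hkm : Measurable k := by
    have := measurable_quantile (π := π)
    fun_prop
  -- Since κb = 1, the power -b/2 turns (u/v)^κ into (v/u)^(1/2), and v^(1/2) ≤ exp(v/2).
  have hpow : ∀ v, u ≤ v → Real.exp (-(s * c * (u / v) ^ κ)) ≤ B * Real.exp (v / 2) := fun v hv => by
    have hv0 := hu.trans_le hv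
    refine (exp_neg_le_rpow_neg (δ := b / 2) (by positivity) (by positivity) (by linarith)).trans ?_
    rw [Real.mul_rpow (by positivity) (by positivity), ← Real.rpow_mul (by positivity),
      show κ * -(b / 2 : ℝ) = -(1 / 2) by simp only [κ]; field_simp, Real.div_rpow hu.le hv0.le,
      Real.rpow_neg hv0.le, div_inv_eq_mul, ← mul_assoc]
    gcongr
    calc v ^ (1 / 2 : ℝ) ≤ Real.exp v ^ (1 / 2 : ℝ) := by
          have := Real.add_one_le_exp v
          gcongr
          linarith
      _ = Real.exp (v / 2) := by rw [← Real.exp_mul]; ring_nf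
  have hnoise : ∀ v, x₀ * Λ ≤ v → u ≤ v → q ≤ Real.exp (-(s * c * (u / v) ^ κ)) := fun v hv huv => by
    have hv0 := hu.trans_le huv
    refine Real.exp_le_exp.2 (neg_le_neg ?_)
    rw [mul_div_assoc, mul_assoc]
    gcongr
    rw [le_div_iff₀ h0]
    calc c * (u / v) ^ κ * g ≤ (W * x₀ ^ κ / C) * (u / v) ^ κ * (C * (u / Λ) ^ (-κ)) := by
          gcongr
          · exact min_le_right _ _
          · exact hP2 _ ⟨by positivity, (div_lt_one hΛ).2 huΛ⟩
      _ = W * (x₀ * (u / v) * (u / Λ)⁻¹) ^ κ := by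
          rw [Real.mul_rpow (by positivity) (by positivity), Real.mul_rpow (by positivity)
            (by positivity), Real.inv_rpow (by positivity), Real.rpow_neg (by positivity)]
          field_simp
      _ ≤ W * 1 := by
          gcongr
          refine Real.rpow_le_one (by positivity) ?_ hκ.le
          rw [inv_div, show x₀ * (u / v) * (Λ / u) = x₀ * Λ / v by field_simp, div_le_one hv0]
          exact hv
      _ = W := mul_one W
  have hqk : ∀ v, u ≤ v → v ≤ Λ → q * k v ≤ B * Real.exp (v / 2) := fun v huv hvΛ => by
    have hv0 := hu.trans_le huv
    refine le_trans ?_ (hpow v huv)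
    rcases le_total (x₀ * Λ) v with hv | hv
    · have := hnoise v hv huv
      have := hk1 v
      have : 0 < q := Real.exp_pos _
      nlinarith
    · have h1 := hP (u / Λ) (v / Λ) (by positivity) (by gcongr) ((div_le_iff₀ hΛ).2 hv)
      rw [div_div_div_cancel_right₀ hΛ.ne'] at h1
      have h2 : c * (u / v) ^ κ ≤ quantile π (v / Λ) / g := by
        rw [le_div_iff₀ h0]
        calc c * (u / v) ^ κ * g ≤ 1 / 2 * (u / v) ^ κ * (2 * (v / u) ^ κ * quantile π (v / Λ)) := by
              gcongr
              exact min_le_left _ _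
          _ = (u / v * (v / u)) ^ κ * quantile π (v / Λ) := by
              rw [Real.mul_rpow (by positivity) (by positivity)]; ring
          _ = _ := by rw [div_mul_div_cancel₀ hv0.ne', div_self hu.ne', Real.one_rpow, one_mul]
      have h3 : k v ≤ Real.exp (-(s * c * (u / v) ^ κ)) := by
        refine Real.exp_le_exp.2 (neg_le_neg ?_)
        rw [mul_assoc]
        gcongr
      have : 0 < k v := Real.exp_pos _
      nlinarith
  have hqΛ : q ≤ B * Real.exp (Λ / 2) := (hnoise Λ (by nlinarith) huΛ.le).trans (hpow Λ huΛ.le)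
  have hFTC := integral_mul_exp_integral (h := k) (c := Λ) huΛ.le hkm hki
    (D := {v | v ∈ Ioi 0 ∧ ¬ ContinuousWithinAt (fun v => quantile π (v / Λ)) (Ioi 0) v})
    (AntitoneOn.countable_not_continuousWithinAt fun x hx y hy hxy =>
      antitoneOn_quantile (div_pos hx hΛ) (div_pos hy hΛ) (by gcongr)) fun v hv => by
        have hv0 : 0 < v := hu.trans hv.1.1
        have : ContinuousAt (fun v => quantile π (v / Λ)) v := by
          by_contra hcon
          exact hv.2 ⟨hv0, fun h => hcon (h.continuousAt (Ioi_mem_nhds hv0))⟩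
        fun_prop
  rw [intervalIntegral.integral_same, Real.exp_zero] at hFTC
  have hcont : Continuous fun x => Real.exp (∫ y in x..Λ, k y) := by
    refine Real.continuous_exp.comp ?_
    simp_rw [intervalIntegral.integral_symm Λ]
    exact (intervalIntegral.continuous_primitive hki Λ).neg
  have hbound : ∫ v in u..Λ, q * Real.exp (-Λ) * (k v * Real.exp (∫ y in v..Λ, k y)) ≤
      ∫ v in u..Λ, B * Real.exp (-(1 / 2) * v) := by
    refine intervalIntegral.integral_mono_on huΛ.le
      (((hki u Λ).mul_continuousOn hcont.continuousOn).const_mul _)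
      (Continuous.intervalIntegrable (by fun_prop) _ _) fun v hv => ?_
    have h1 : ∫ y in v..Λ, k y ≤ Λ - v := integral_exp_ratio_le hs.le h0.le hv.2
    calc q * Real.exp (-Λ) * (k v * Real.exp (∫ y in v..Λ, k y))
        = q * k v * Real.exp (-Λ + ∫ y in v..Λ, k y) := by rw [Real.exp_add]; ring
      _ ≤ B * Real.exp (v / 2) * Real.exp (-v) := by
          exact mul_le_mul (hqk v hv.1 hv.2) (Real.exp_le_exp.2 (by linarith))
            (Real.exp_pos _).le (by positivity)
      _ = _ := by rw [mul_assoc, ← Real.exp_add]; ring_nf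
  have hint : ∫ v in u..Λ, B * Real.exp (-(1 / 2) * v) =
      2 * B * (Real.exp (-(1 / 2) * u) - Real.exp (-(1 / 2) * Λ)) := by
    rw [intervalIntegral.integral_const_mul, intervalIntegral.integral_comp_mul_left
      (fun x => Real.exp x) (by norm_num), integral_exp, smul_eq_mul]
    ring
  rw [sinrDensity_div_eq hu huΛ h0]
  refine ENNReal.ofReal_le_ofReal ?_
  rw [intervalIntegral.integral_const_mul, hFTC, hint] at hbound
  have hB : 0 < B := by positivity
  have hlast : q * Real.exp (-Λ) ≤ B * Real.exp (-(1 / 2) * Λ) := by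
    calc q * Real.exp (-Λ) ≤ B * Real.exp (Λ / 2) * Real.exp (-Λ) := by gcongr
      _ = _ := by rw [mul_assoc, ← Real.exp_add]; ring_nf
  have hfinal : q * Real.exp (-(Λ - ∫ v in u..Λ, k v)) =
      q * Real.exp (-Λ) * Real.exp (∫ v in u..Λ, k v) := by
    rw [mul_assoc, ← Real.exp_add (-Λ)]
    congr 2
    ring
  have hE := mul_pos hB (Real.exp_pos (-(1 / 2) * Λ))
  calc q * Real.exp (-(Λ - ∫ v in u..Λ, k v)) ≤ 2 * B * Real.exp (-(1 / 2) * u) := by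
        rw [hfinal]; linarith
    _ = _ := by simp only [B]; ring

/-- For α > 0 the majorant is 1 for s ≤ 1, and a multiple of s^(-1-δ) for s > 1: the weight gives
1/s and the uniform density bound gives s^(-δ). -/
theorem tendsto_lintegral_logWeight_mul (h : RegVaryingNeg (fun t => π.real (Ioi t)) α)
    (hW : 0 < W) :
    Tendsto (fun Λ => ∫⁻ s in Ioi 0, logWeight s * sinrLaplace (quantile π) W Λ s) atTop
      (𝓝 (limitRate α)) := by
  have hG : Measurable (quantile π) := measurable_quantile
  have hmeas : ∀ Λ, Measurable fun s => logWeight s * sinrLaplace (quantile π) W Λ s := fun Λ =>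
    measurable_logWeight.mul (measurable_sinrLaplace hG W Λ)
  have hlim : ∀ᵐ s ∂volume.restrict (Ioi (0 : ℝ)), Tendsto
      (fun Λ => logWeight s * sinrLaplace (quantile π) W Λ s) atTop
      (𝓝 (logWeight s * limitLaplace α s)) := by
    filter_upwards [ae_restrict_mem measurableSet_Ioi] with s (hs : 0 < s)
    exact ENNReal.Tendsto.const_mul (tendsto_sinrLaplace h hW.le hs)
      (Or.inr ((logWeight_le_one hs.le).trans_lt ENNReal.one_lt_top).ne)
  rcases eq_or_ne α 0 with rfl | hα
  · rw [limitRate_zero]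
    exact tendsto_lintegral_top hmeas hlim limitRate_zero
  obtain ⟨δ, c, hδ, hc, hle⟩ := exists_sinrDensity_div_le h (pos_iff_ne_zero.2 hα) hW
  set I := ∫⁻ u in Ioi 0, ENNReal.ofReal (u ^ (-(1 / 2) : ℝ) * Real.exp (-(1 / 2) * u))
  have hI : I ≠ ⊤ := by
    have hi := integrableOn_rpow_mul_exp_neg_mul_rpow (p := 1) (s := -(1 / 2)) (b := 1 / 2)
      (by norm_num) (by norm_num) (by norm_num)
    simp_rw [Real.rpow_one] at hi
    refine (lintegral_ofReal_ne_top_iff_integrable hi.aestronglyMeasurable ?_).2 hi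
    filter_upwards [ae_restrict_mem measurableSet_Ioi] with u (hu : 0 < u)
    simp only [Pi.zero_apply]
    positivity
  refine tendsto_lintegral_filter_of_dominated_convergence
    (fun s => (Iic 1).indicator (fun _ => 1) s + (Ioi 1).indicator (fun s =>
      ENNReal.ofReal (2 * c ^ (-δ) * s ^ (-1 - δ)) * I) s) (Eventually.of_forall hmeas) ?_ ?_ hlim
  · filter_upwards [eventually_gt_atTop 0] with Λ hΛ
    filter_upwards [ae_restrict_mem measurableSet_Ioi] with s (hs : 0 < s)
    rw [sinrLaplace_eq_div hG W s hΛ]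
    rcases le_or_gt s 1 with hs1 | hs1
    · rw [indicator_of_mem (by exact hs1), indicator_of_notMem (by simpa using hs1), add_zero]
      refine mul_le_one' (logWeight_le_one hs.le) ?_
      rw [← lintegral_exp_neg_Ioi_zero]
      exact setLIntegral_mono' measurableSet_Ioi fun u hu => sinrDensity_div_le_exp hW.le hΛ hs.le hu
    · rw [indicator_of_notMem (by simpa using hs1), indicator_of_mem (by exact hs1), zero_add]
      calc logWeight s * ∫⁻ u in Ioi 0, sinrDensity (quantile π) W Λ s (u / Λ)
          ≤ ENNReal.ofReal s⁻¹ * ∫⁻ u in Ioi 0, ENNReal.ofReal (2 * (s * c) ^ (-δ)) *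
              ENNReal.ofReal (u ^ (-(1 / 2) : ℝ) * Real.exp (-(1 / 2) * u)) := by
            refine mul_le_mul' (logWeight_le_inv hs) ?_
            refine setLIntegral_mono' measurableSet_Ioi fun u hu => ?_
            rw [← ENNReal.ofReal_mul (by positivity)]
            exact hle Λ s u hΛ hs hu
        _ = _ := by
            rw [lintegral_const_mul' _ _ ENNReal.ofReal_ne_top, ← mul_assoc, ← ENNReal.ofReal_mul (by positivity)]
            congr 2
            rw [Real.mul_rpow hs.le hc.le, sub_eq_add_neg, Real.rpow_add hs, Real.rpow_neg_one]
            ring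
  · rw [lintegral_add_left (measurable_const.indicator measurableSet_Iic),
      lintegral_indicator measurableSet_Iic, lintegral_indicator measurableSet_Ioi,
      Measure.restrict_restrict measurableSet_Iic, Measure.restrict_restrict measurableSet_Ioi,
      lintegral_mul_const' _ _ hI, inter_eq_left.2 (Ioi_subset_Ioi zero_le_one)]
    refine ENNReal.add_ne_top.2 ⟨by rw [inter_comm, Ioi_inter_Iic]; simp, ENNReal.mul_ne_top ?_ hI⟩
    have hi : IntegrableOn (fun s : ℝ => 2 * c ^ (-δ) * s ^ (-1 - δ)) (Ioi 1) :=
      (integrableOn_Ioi_rpow_of_lt (by linarith) one_pos).const_mul _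
    refine (lintegral_ofReal_ne_top_iff_integrable hi.aestronglyMeasurable ?_).2 hi
    filter_upwards [ae_restrict_mem measurableSet_Ioi] with s (hs : 1 < s)
    simp only [Pi.zero_apply]
    positivity

end Rate

/-! ### Limits for realizations of a network, and the comparison -/

theorem tendsto_expected_nodes {d : ℕ} (net : Network d) :
    Tendsto (fun lam : ℝ≥0 => (lam : ℝ) * volume.real net.domain) atTop atTop :=
  (NNReal.tendsto_coe_atTop.2 tendsto_id).atTop_mul_const net.measureReal_domain_pos

variable {d : ℕ} {net : Network d} {α : ℝ≥0∞}

theorem RegVaryingNeg.powerLaw (h : RegVaryingNeg net.tail α) :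
    RegVaryingNeg (fun t => net.powerLaw.real (Ioi t)) α :=
  net.tail_eq ▸ h

theorem tendsto_meanRate (h : RegVaryingNeg net.tail α) (Ξ : ∀ lam : ℝ≥0, Realization net lam) :
    Tendsto (fun lam => (Ξ lam).meanRate) atTop (𝓝 (limitRate α)) := by
  simp_rw [Realization.meanRate_eq]
  exact (tendsto_lintegral_logWeight_mul h.powerLaw net.noise_pos).comp (tendsto_expected_nodes net)

theorem tendsto_meanSinr_of_lt_top (h : RegVaryingNeg net.tail α)
    (Ξ : ∀ lam : ℝ≥0, Realization net lam) (hm : net.meanPower < ⊤) :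
    Tendsto (fun lam => (Ξ lam).meanSinr) atTop (𝓝 0) := by
  simp_rw [Realization.meanSinr_eq]
  rw [net.meanPower_eq] at hm
  refine (tendsto_lintegral_sinrLaplace net.noise_pos ?_ hm).comp (tendsto_expected_nodes net)
  obtain ⟨x, hx, hx0⟩ := ((tendsto_quantile_zero fun t ht => h.powerLaw.pos ht).eventually_gt_atTop 0
    |>.and (Ioo_mem_nhdsGT one_pos)).exists
  exact ⟨x, hx0, hx⟩

theorem tendsto_meanSinr_of_eq_top (Ξ : ∀ lam : ℝ≥0, Realization net lam)
    (hm : net.meanPower = ⊤) : Tendsto (fun lam => (Ξ lam).meanSinr) atTop (𝓝 ⊤) := by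
  rw [net.meanPower_eq] at hm
  refine tendsto_const_nhds.congr' ?_
  filter_upwards [eventually_gt_atTop 0] with lam hlam
  rw [Realization.meanSinr_eq, lintegral_sinrLaplace_eq_top net.noise_pos
    (mul_pos (by exact_mod_cast hlam) net.measureReal_domain_pos) hm]

theorem meanPower_lt_top (h : RegVaryingNeg net.tail α) (hα : 1 < α) : net.meanPower < ⊤ := by
  rw [net.meanPower_eq]
  exact lintegral_quantile_lt_top h.powerLaw hα

theorem meanPower_eq_top (h : RegVaryingNeg net.tail α) (hα : α < 1) : net.meanPower = ⊤ := by
  rw [net.meanPower_eq]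
  exact lintegral_quantile_eq_top h.powerLaw hα

end DenseNetwork

theorem theorem4 (d : ℕ) (hd : 1 ≤ d)
    (net₁ net₂ : DenseNetwork.Network d)
    (Ξ₁ : ∀ lam : ℝ≥0, DenseNetwork.Realization.{u} net₁ lam)
    (Ξ₂ : ∀ lam : ℝ≥0, DenseNetwork.Realization.{v} net₂ lam)
    (α₁ α₂ : ℝ≥0∞) (hα : α₁ ≤ α₂)
    (h₁ : DenseNetwork.RegVaryingNeg net₁.tail α₁)
    (h₂ : DenseNetwork.RegVaryingNeg net₂.tail α₂) :
    ((α₁ = 1 → α₂ = 1 → net₁.meanPower < ⊤ → net₂.meanPower < ⊤) →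
      ∃ s₁ s₂ : ℝ≥0∞,
        Tendsto (fun lam => (Ξ₁ lam).meanSinr) atTop (𝓝 s₁) ∧
        Tendsto (fun lam => (Ξ₂ lam).meanSinr) atTop (𝓝 s₂) ∧ s₂ ≤ s₁) ∧
    ∃ c₁ c₂ : ℝ≥0∞,
      Tendsto (fun lam => (Ξ₁ lam).meanRate) atTop (𝓝 c₁) ∧
      Tendsto (fun lam => (Ξ₂ lam).meanRate) atTop (𝓝 c₂) ∧ c₂ ≤ c₁ := by
  refine ⟨fun hprov => ?_, DenseNetwork.limitRate α₁, DenseNetwork.limitRate α₂,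
    DenseNetwork.tendsto_meanRate h₁ Ξ₁, DenseNetwork.tendsto_meanRate h₂ Ξ₂,
    DenseNetwork.limitRate_anti hα⟩
  rcases eq_or_ne net₁.meanPower ⊤ with hm₁ | hm₁
  · have hlim₁ := DenseNetwork.tendsto_meanSinr_of_eq_top Ξ₁ hm₁
    rcases eq_or_ne net₂.meanPower ⊤ with hm₂ | hm₂
    · exact ⟨⊤, ⊤, hlim₁, DenseNetwork.tendsto_meanSinr_of_eq_top Ξ₂ hm₂, le_rfl⟩
    · exact ⟨⊤, 0, hlim₁, DenseNetwork.tendsto_meanSinr_of_lt_top h₂ Ξ₂ hm₂.lt_top, zero_le⟩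
  · have h1 : 1 ≤ α₁ := not_lt.1 fun h => hm₁ (DenseNetwork.meanPower_eq_top h₁ h)
    -- A finite first mean forces 1 ≤ α₁ ≤ α₂. The second mean is then finite by integrability if α₂
    -- > 1; if α₂ = 1, both indices are 1 and the proviso applies.
    have hm₂ : net₂.meanPower < ⊤ := by
      rcases (h1.trans hα).eq_or_lt with h2 | h2
      · exact hprov (le_antisymm (hα.trans h2.ge) h1) h2.symm hm₁.lt_top
      · exact DenseNetwork.meanPower_lt_top h₂ h2
    exact ⟨0, 0, DenseNetwork.tendsto_meanSinr_of_lt_top h₁ Ξ₁ hm₁.lt_top,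
      DenseNetwork.tendsto_meanSinr_of_lt_top h₂ Ξ₂ hm₂, le_rfl⟩
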